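/- Let $T$ be a finite set and $c\in\mathbb N$. A $T$-labelled partial order $\ell=(V,<,l)$ is finite, and it is a $c$-partial order if its Hasse diagram $\mathrm{tr}(\ell)$ is a union of $c$ (not necessarily disjoint or distinct) simple directed paths, single vertices being paths. DAGs are finite, have vertex labels in $T$, and may have parallel edges; DAGs and partial orders are taken up to isomorphism. A DAG is transitively reduced if no proper subgraph on the same vertices has the same transitive closure. MSO formulas over partial orders are built from $x\in X$, $x<y$, $l(x,a)$ ($a\in T$) by $\wedge,\vee,\neg$ and quantifiers $\exists x,\exists X$ over vertices and vertex sets; MSO$_2$ formulas over DAGs are built from $x\in X$, $y\in Y$, $s(y,x)$, $t(y,x)$ (source and target of an edge), $l(x,a)$ by $\wedge,\vee,\neg$ and existential quantifiers over vertices, edges, vertex sets and edge sets. A unit slice is a DAG with one center vertex labelled in $T$, in-frontier vertices $1,\dots,m$ and out-frontier vertices $1,\dots,n$, in which every frontier vertex is the endpoint of exactly one edge, and every edge starts in the in-frontier or the center and ends in the center or the out-frontier; its width is $\max(m,n)$. Slices are glued by fusing the edge ending at the $i$-th out-frontier vertex of the first with the edge starting at the $i$-th in-frontier vertex of the second. $\Sigma(c,T)$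 is the finite set of unit slices of width at most $c$ (up to isomorphism). A unit decomposition is a (possibly empty) sequence $U=S_1\cdots S_n$ of consecutively glueable unit slices, the first with empty in-frontier and the last with empty out-frontier, and $\mathring U=S_1\circ\dots\circ S_n$ is the DAG obtained by gluing. A slice automaton over $\Sigma(c,T)$ is a finite (nondeterministic) automaton over this alphabet with one initial state, in which transitions leaving the initial state carry slices with empty in-frontier, transitions entering a final state carry slices with empty out-frontier, and consecutive transitions carry glueable slices. A slice language $L$ is saturated if for every $U\in L$ all unit decompositions, of any width, of the DAG $\mathring U$ belong to $L$; it is transitively reduced if $\mathring U$ is transitively reduced for every $U\in L$; and $L_{po}$ is the set of transitive closures of the DAGs $\mathring U$, $U\in L$. An automaton is saturated or transitively reduced if its language is, and $L_{po}(\mathcal A)$ denotes $L(\mathcal A)_{po}$. Let $\varphi$ be an MSO sentence over $T$-labelled partial orders. Let $\varphi^{gr}$ be the MSO$_2$ sentence obtained from $\varphi$ by replacing each atom $x<x'$ by an MSO$_2$ formula saying that there is a path from $x$ to $x'\neq x$, and let $\rho$ and $\gamma(c)$ be the standard MSO$_2$ sentences expressing that a DAG is transitively reduced and that it is a union of $c$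 paths, respectively. Then $\ell\models\varphi$ if and only if $\mathrm{tr}(\ell)\models\varphi^{gr}$ for every $T$-labelled partial order $\ell$; a DAG satisfies $\rho$ if and only if it is transitively reduced; and it satisfies $\gamma(c)$ if and only if it is a union of $c$ paths. There is a slice automaton $\mathcal A(c,T,\varphi^{gr}\wedge\rho\wedge\gamma(c))$ over $\Sigma(c,T)$ that accepts exactly the unit decompositions $U$ over $\Sigma(c,T)$ with $\mathring U\models\varphi^{gr}\wedge\rho\wedge\gamma(c)$, and every such automaton is saturated and transitively reduced, and satisfies $$L_{po}\big(\mathcal A(c,T,\varphi^{gr}\wedge\rho\wedge\gamma(c))\big)=\mathcal P(c,T,\varphi),$$ the set of all $T$-labelled $c$-partial orders satisfying $\varphi$. -/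

import Mathlib

open Relation

universe u

/-! ### Labelled DAGs and labelled partial orders -/

/-- A finite `T`-labelled directed acyclic graph `(V, E, s, t, l)`. Parallel edges are allowed. -/
structure LDAG (T : Type u) where
  V : Type
  E : Type
  finV : Finite V
  finE : Finite E
  src : E → V
  tgt : E → V
  label : V → T
  acyclic : ∀ v, ¬ TransGen (fun a b => ∃ e, src e = a ∧ tgt e = b) v v

/-- A finite `T`-labelled partial order `(V, <, l)`, given by its strict order relation. -/
structure LPO (T : Type u) where
  V : Type
  finV : Finite V
  lt : V → V → Prop
  strict : IsStrictOrder V lt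
  label : V → T

namespace LDAG

variable {T : Type u}

/-- `u` and `v` are joined, in this direction, by an edge belonging to `F`. -/
def AdjOn (H : LDAG T) (F : Set H.E) (u v : H.V) : Prop :=
  ∃ e ∈ F, H.src e = u ∧ H.tgt e = v

/-- There is an edge from `u` to `v`. -/
def Adj (H : LDAG T) (u v : H.V) : Prop := ∃ e, H.src e = u ∧ H.tgt e = v

/-- Isomorphism of labelled DAGs. -/
structure Iso (H K : LDAG T) where
  vEquiv : H.V ≃ K.V
  eEquiv : H.E ≃ K.E
  src_eq : ∀ e, K.src (eEquiv e) = vEquiv (H.src e)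
  tgt_eq : ∀ e, K.tgt (eEquiv e) = vEquiv (H.tgt e)
  label_eq : ∀ v, K.label (vEquiv v) = H.label v

/-- The partial order obtained by transitive closure. -/
def tc (H : LDAG T) : LPO T where
  V := H.V
  finV := H.finV
  lt := TransGen H.Adj
  strict := { irrefl := H.acyclic, trans := fun _ _ _ => TransGen.trans }
  label := H.label

/-- `H` is its own transitive reduction: no proper subgraph (on the same vertices) has the same
transitive closure. -/
def IsTransReduced (H : LDAG T) : Prop :=
  ∀ F : Set H.E, (∀ u v, TransGen (H.AdjOn F) u v ↔ TransGen H.Adj u v) → F = Set.univ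

/-- `X` and `Y` are the vertex set and the edge set of a simple directed path from `a` to `b`.
A single vertex is a path. -/
def IsPathFromTo (H : LDAG T) (a b : H.V) (X : Set H.V) (Y : Set H.E) : Prop :=
  ∃ (k : ℕ) (v : Fin (k + 1) → H.V) (e : Fin k → H.E), Function.Injective v ∧
    (∀ i, H.src (e i) = v i.castSucc ∧ H.tgt (e i) = v i.succ) ∧
    v 0 = a ∧ v (Fin.last k) = b ∧ X = Set.range v ∧ Y = Set.range e

/-- `X` and `Y` are the vertex set and the edge set of a simple directed path. -/
def IsPath (H : LDAG T) (X : Set H.V) (Y : Set H.E) : Prop :=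
  ∃ a b, H.IsPathFromTo a b X Y

/-- `H` is the union of `c` (not necessarily disjoint or distinct) paths. -/
def CoverableBy (H : LDAG T) (c : ℕ) : Prop :=
  ∃ (X : Fin c → Set H.V) (Y : Fin c → Set H.E), (∀ i, H.IsPath (X i) (Y i)) ∧
    (∀ v, ∃ i, v ∈ X i) ∧ (∀ e, ∃ i, e ∈ Y i)

end LDAG

namespace LPO

variable {T : Type u}

/-- Isomorphism of labelled partial orders. -/
def IsIso (ℓ ℓ' : LPO T) : Prop :=
  ∃ f : ℓ.lt ≃r ℓ'.lt, ∀ v, ℓ'.label (f v) = ℓ.label v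

/-- The covering relation. -/
def Covers (ℓ : LPO T) (u v : ℓ.V) : Prop := ℓ.lt u v ∧ ¬ ∃ w, ℓ.lt u w ∧ ℓ.lt w v

/-- The Hasse diagram (transitive reduction) of a partial order. -/
def hasse (ℓ : LPO T) : LDAG T where
  V := ℓ.V
  E := {p : ℓ.V × ℓ.V // ℓ.Covers p.1 p.2}
  finV := ℓ.finV
  finE := by
    have := ℓ.finV
    infer_instance
  src := fun e => e.1.1
  tgt := fun e => e.1.2
  label := ℓ.label
  acyclic := by
    intro v hv
    have := ℓ.strict
    have key : ∀ w, TransGen (fun a b => ∃ e : {p : ℓ.V × ℓ.V // ℓ.Covers p.1 p.2},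
        e.1.1 = a ∧ e.1.2 = b) v w → ℓ.lt v w := by
      intro w hw
      induction hw with
      | single h => obtain ⟨e, rfl, rfl⟩ := h; exact e.2.1
      | tail _ h ih => obtain ⟨e, rfl, rfl⟩ := h; exact _root_.trans ih e.2.1
    exact irrefl_of ℓ.lt v (key v hv)

end LPO

/-! ### Monadic second order logic of partial orders -/

/-- MSO formulas over `T`-labelled partial orders, with `n` free vertex variables and `p` free
vertex set variables. Below a quantifier, variable `0` is the bound one and the old variables are
shifted by one. -/
inductive MSO (T : Type u) : ℕ → ℕ → Type u
  | mem {n p : ℕ} (x : Fin n) (X : Fin p) : MSO T n p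
  | lt {n p : ℕ} (x y : Fin n) : MSO T n p
  | lab {n p : ℕ} (x : Fin n) (a : T) : MSO T n p
  | and {n p : ℕ} (φ ψ : MSO T n p) : MSO T n p
  | or {n p : ℕ} (φ ψ : MSO T n p) : MSO T n p
  | not {n p : ℕ} (φ : MSO T n p) : MSO T n p
  | exV {n p : ℕ} (φ : MSO T (n + 1) p) : MSO T n p
  | exVS {n p : ℕ} (φ : MSO T n (p + 1)) : MSO T n p

/-- Truth of an MSO formula in a labelled partial order under an assignment. -/
def MSO.Sat {T : Type u} (ℓ : LPO T) :
    {n p : ℕ} → MSO T n p → (Fin n → ℓ.V) → (Fin p → Set ℓ.V) → Prop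
  | _, _, .mem x X, xs, Xs => xs x ∈ Xs X
  | _, _, .lt x y, xs, _ => ℓ.lt (xs x) (xs y)
  | _, _, .lab x a, xs, _ => ℓ.label (xs x) = a
  | _, _, .and φ ψ, xs, Xs => φ.Sat ℓ xs Xs ∧ ψ.Sat ℓ xs Xs
  | _, _, .or φ ψ, xs, Xs => φ.Sat ℓ xs Xs ∨ ψ.Sat ℓ xs Xs
  | _, _, .not φ, xs, Xs => ¬ φ.Sat ℓ xs Xs
  | _, _, .exV φ, xs, Xs => ∃ v, φ.Sat ℓ (Matrix.vecCons v xs) Xs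
  | _, _, .exVS φ, xs, Xs => ∃ A, φ.Sat ℓ xs (Matrix.vecCons A Xs)

/-- An MSO sentence is a formula without free variables. -/
abbrev MSOSentence (T : Type u) : Type u := MSO T 0 0

/-- A partial order satisfies a sentence. -/
def LPO.Models {T : Type u} (ℓ : LPO T) (φ : MSOSentence T) : Prop := φ.Sat ℓ ![] ![]

/-! ### Monadic second order logic of DAGs, with edge set quantification -/

/-- MSO₂ formulas over `T`-labelled DAGs with `n` free vertex variables, `m` free edge variables,
`p` free vertex set variables and `q` free edge set variables. Below a quantifier, variable `0` of
its sort is the bound one and the old variables of that sort are shifted by one. -/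
inductive MSO₂ (T : Type u) : ℕ → ℕ → ℕ → ℕ → Type u
  | memV {n m p q : ℕ} (x : Fin n) (X : Fin p) : MSO₂ T n m p q
  | memE {n m p q : ℕ} (y : Fin m) (Y : Fin q) : MSO₂ T n m p q
  | src {n m p q : ℕ} (y : Fin m) (x : Fin n) : MSO₂ T n m p q
  | tgt {n m p q : ℕ} (y : Fin m) (x : Fin n) : MSO₂ T n m p q
  | lab {n m p q : ℕ} (x : Fin n) (a : T) : MSO₂ T n m p q
  | and {n m p q : ℕ} (φ ψ : MSO₂ T n m p q) : MSO₂ T n m p q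
  | or {n m p q : ℕ} (φ ψ : MSO₂ T n m p q) : MSO₂ T n m p q
  | not {n m p q : ℕ} (φ : MSO₂ T n m p q) : MSO₂ T n m p q
  | exV {n m p q : ℕ} (φ : MSO₂ T (n + 1) m p q) : MSO₂ T n m p q
  | exE {n m p q : ℕ} (φ : MSO₂ T n (m + 1) p q) : MSO₂ T n m p q
  | exVS {n m p q : ℕ} (φ : MSO₂ T n m (p + 1) q) : MSO₂ T n m p q
  | exES {n m p q : ℕ} (φ : MSO₂ T n m p (q + 1)) : MSO₂ T n m p q

/-- Truth of an MSO₂ formula in a labelled DAG under an assignment. -/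
def MSO₂.Sat {T : Type u} (H : LDAG T) : {n m p q : ℕ} → MSO₂ T n m p q →
    (Fin n → H.V) → (Fin m → H.E) → (Fin p → Set H.V) → (Fin q → Set H.E) → Prop
  | _, _, _, _, .memV x X, xs, _, Xs, _ => xs x ∈ Xs X
  | _, _, _, _, .memE y Y, _, ys, _, Ys => ys y ∈ Ys Y
  | _, _, _, _, .src y x, xs, ys, _, _ => H.src (ys y) = xs x
  | _, _, _, _, .tgt y x, xs, ys, _, _ => H.tgt (ys y) = xs x
  | _, _, _, _, .lab x a, xs, _, _, _ => H.label (xs x) = a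
  | _, _, _, _, .and φ ψ, xs, ys, Xs, Ys => φ.Sat H xs ys Xs Ys ∧ ψ.Sat H xs ys Xs Ys
  | _, _, _, _, .or φ ψ, xs, ys, Xs, Ys => φ.Sat H xs ys Xs Ys ∨ ψ.Sat H xs ys Xs Ys
  | _, _, _, _, .not φ, xs, ys, Xs, Ys => ¬ φ.Sat H xs ys Xs Ys
  | _, _, _, _, .exV φ, xs, ys, Xs, Ys => ∃ v, φ.Sat H (Matrix.vecCons v xs) ys Xs Ys
  | _, _, _, _, .exE φ, xs, ys, Xs, Ys => ∃ e, φ.Sat H xs (Matrix.vecCons e ys) Xs Ys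
  | _, _, _, _, .exVS φ, xs, ys, Xs, Ys => ∃ A, φ.Sat H xs ys (Matrix.vecCons A Xs) Ys
  | _, _, _, _, .exES φ, xs, ys, Xs, Ys => ∃ B, φ.Sat H xs ys Xs (Matrix.vecCons B Ys)

/-- An MSO₂ sentence is a formula without free variables. -/
abbrev MSO₂Sentence (T : Type u) : Type u := MSO₂ T 0 0 0 0

/-- A DAG satisfies a sentence. -/
def LDAG.Models {T : Type u} (H : LDAG T) (φ : MSO₂Sentence T) : Prop := φ.Sat H ![] ![] ![] ![]

namespace MSO₂

variable {T : Type u} {n m p q : ℕ}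

def imp (φ ψ : MSO₂ T n m p q) : MSO₂ T n m p q := .or (.not φ) ψ

def allV (φ : MSO₂ T (n + 1) m p q) : MSO₂ T n m p q := .not (.exV (.not φ))

def allE (φ : MSO₂ T n (m + 1) p q) : MSO₂ T n m p q := .not (.exE (.not φ))

/-- Equality of vertices: every vertex set containing `x` contains `x'`. -/
def eqV (x x' : Fin n) : MSO₂ T n m p q := .not (.exVS (.and (.memV x 0) (.not (.memV x' 0))))

/-- Equality of edges: every edge set containing `y` contains `y'`. -/
def eqE (y y' : Fin m) : MSO₂ T n m p q := .not (.exES (.and (.memE y 0) (.not (.memE y' 0))))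

def fls : MSO₂ T n m p q := .exVS (.exV (.and (.memV 0 0) (.not (.memV 0 0))))

/-- Finite conjunction. -/
def bigAnd {c : ℕ} (φ : Fin c → MSO₂ T n m p q) : MSO₂ T n m p q :=
  (List.ofFn φ).foldr .and (.not fls)

/-- Finite disjunction. -/
def bigOr {c : ℕ} (φ : Fin c → MSO₂ T n m p q) : MSO₂ T n m p q :=
  (List.ofFn φ).foldr .or fls

/-- Existential quantification over all vertex set variables. -/
def exVSs : (p : ℕ) → MSO₂ T n m p q → MSO₂ T n m 0 q
  | 0, φ => φ
  | p + 1, φ => exVSs p (.exVS φ)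

/-- Existential quantification over all edge set variables. -/
def exESs : (q : ℕ) → MSO₂ T n m p q → MSO₂ T n m p 0
  | 0, φ => φ
  | q + 1, φ => exESs q (.exES φ)

/-- `path(x, X, Y, x')`: in a DAG, `X` and `Y` are the vertex set and the edge set of a directed
path from `x` to `x'`. The conjuncts say, in this order: `x` and `x'` belong to `X`; the endpoints
of every edge in `Y` belong to `X`; edges of `Y` with the same source, or with the same target, are
equal; every vertex in `X` other than `x'` is the source of an edge in `Y`; every vertex in `X`
other than `x` is the target of an edge in `Y`; no edge in `Y` has target `x` or source `x'`. -/
def path (x x' : Fin n) (X : Fin p) (Y : Fin q) : MSO₂ T n m p q :=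
  .and (.and (.memV x X) (.memV x' X)) <|
  .and (allE (allV (imp (.and (.memE 0 Y) (.or (.src 0 0) (.tgt 0 0))) (.memV 0 X)))) <|
  .and (allE (allE (allV (imp
    (.and (.and (.memE 0 Y) (.memE 1 Y))
      (.or (.and (.src 0 0) (.src 1 0)) (.and (.tgt 0 0) (.tgt 1 0))))
    (eqE 0 1))))) <|
  .and (allV (imp (.memV 0 X) (.or (eqV 0 x'.succ) (.exE (.and (.memE 0 Y) (.src 0 0)))))) <|
  .and (allV (imp (.memV 0 X) (.or (eqV 0 x.succ) (.exE (.and (.memE 0 Y) (.tgt 0 0)))))) <|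
  .not (.exE (.and (.memE 0 Y) (.or (.tgt 0 x) (.src 0 x'))))

/-- The sentence saying that a DAG is transitively reduced: no edge can be bypassed by a path that
does not use it. -/
def rho : MSO₂Sentence T :=
  .not (.exE (.exV (.exV (.and (.and (.src 0 0) (.tgt 0 1))
    (.exVS (.exES (.and (path 0 1 0 0) (.not (.memE 0 0)))))))))

/-- The sentence saying that a DAG can be covered by `c` paths. -/
def gamma (c : ℕ) : MSO₂Sentence T :=
  exVSs c <| exESs c <|
    .and (bigAnd fun i : Fin c => .exV (.exV (path 0 1 i i))) <|
    .and (allV (bigOr fun i : Fin c => .memV 0 i)) (allE (bigOr fun i : Fin c => .memE 0 i))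

end MSO₂

/-- The translation of MSO formulas over partial orders into MSO₂ formulas over Hasse diagrams:
`x < x'` is replaced by the existence of a path from `x` to `x' ≠ x`. -/
def MSO.gr {T : Type u} : {n p : ℕ} → MSO T n p → MSO₂ T n 0 p 0
  | _, _, .mem x X => .memV x X
  | _, _, .lt x x' => .exVS (.exES (.and (MSO₂.path x x' 0 0) (.not (MSO₂.eqV x x'))))
  | _, _, .lab x a => .lab x a
  | _, _, .and φ ψ => .and φ.gr ψ.gr
  | _, _, .or φ ψ => .or φ.gr ψ.gr
  | _, _, .not φ => .not φ.gr
  | _, _, .exV φ => .exV φ.gr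
  | _, _, .exVS φ => .exVS φ.gr

/-! ### Slices and unit decompositions -/

/-- A slice with in-frontier `Fin inn`, center `C` and out-frontier `Fin out`; the numbering of
the frontier vertices is built in. Edges start in the in-frontier or the center and end in the
center or the out-frontier. -/
structure Slice (T : Type u) where
  inn : ℕ
  out : ℕ
  C : Type
  E : Type
  finC : Finite C
  finE : Finite E
  src : E → Fin inn ⊕ C
  tgt : E → C ⊕ Fin out
  label : C → T
  in_unique : ∀ i, ∃! e, src e = .inl i
  out_unique : ∀ j, ∃! e, tgt e = .inr j
  acyclic : ∀ v, ¬ TransGen (fun a b => ∃ e, src e = .inr a ∧ tgt e = .inl b) v v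

namespace Slice

variable {T : Type u}

/-- The slice without vertices. -/
def empty : Slice T where
  inn := 0
  out := 0
  C := Empty
  E := Empty
  finC := inferInstance
  finE := inferInstance
  src := Empty.elim
  tgt := Empty.elim
  label := Empty.elim
  in_unique := fun i => i.elim0
  out_unique := fun i => i.elim0
  acyclic := fun v => v.elim

/-- The edges `e` and `e'` are to be fused when gluing: `e` ends in the out-frontier vertex of `S`
and `e'` starts in the in-frontier vertex of `S'` with the same number. -/
def Fused (S S' : Slice T) (h : S.out = S'.inn) (e : S.E) (e' : S'.E) : Prop :=
  ∃ i : Fin S.out, S.tgt e = .inr i ∧ S'.src e' = .inl (i.cast h)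

/-- A relation on a disjoint union which never goes back from the second part to the first is
acyclic if it is contained in acyclic relations on both parts. -/
theorem acyclic_sum {α β : Type} (r : α ⊕ β → α ⊕ β → Prop) (r₁ : α → α → Prop)
    (r₂ : β → β → Prop) (h₁ : ∀ a, ¬ TransGen r₁ a a) (h₂ : ∀ b, ¬ TransGen r₂ b b)
    (hl : ∀ a b, r (.inl a) (.inl b) → r₁ a b) (hr : ∀ a b, r (.inr a) (.inr b) → r₂ a b)
    (hn : ∀ a b, ¬ r (.inr a) (.inl b)) (v : α ⊕ β) : ¬ TransGen r v v := by
  have key : ∀ x y, TransGen r x y → (∀ a b, x = .inl a → y = .inl b → TransGen r₁ a b) ∧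
      (∀ a b, x = .inr a → y = .inr b → TransGen r₂ a b) ∧
      (∀ a b, x = .inr a → y ≠ .inl b) := by
    intro x y hxy
    induction hxy with
    | single h =>
      refine ⟨?_, ?_, ?_⟩
      · rintro a b rfl rfl; exact .single (hl _ _ h)
      · rintro a b rfl rfl; exact .single (hr _ _ h)
      · rintro a b rfl rfl; exact hn _ _ h
    | @tail y z _ h ih =>
      obtain ⟨i1, i2, i3⟩ := ih
      refine ⟨?_, ?_, ?_⟩
      · rintro a b rfl rfl
        rcases y with y | y
        · exact (i1 _ _ rfl rfl).tail (hl _ _ h)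
        · exact (hn _ _ h).elim
      · rintro a b rfl rfl
        rcases y with y | y
        · exact (i3 _ _ rfl rfl).elim
        · exact (i2 _ _ rfl rfl).tail (hr _ _ h)
      · rintro a b rfl rfl
        rcases y with y | y
        · exact i3 _ _ rfl rfl
        · exact hn _ _ h
  intro hv
  rcases v with v | v
  · exact h₁ v ((key _ _ hv).1 _ _ rfl rfl)
  · exact h₂ v ((key _ _ hv).2.1 _ _ rfl rfl)

/-- Gluing `S ∘ S'`. The edges are those of `S` not ending in the out-frontier, one edge for each
pair of fused edges, and those of `S'` not starting in the in-frontier. -/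
def glue (S S' : Slice T) (h : S.out = S'.inn) : Slice T where
  inn := S.inn
  out := S'.out
  C := S.C ⊕ S'.C
  E := {e : S.E // (S.tgt e).isLeft} ⊕ {p : S.E × S'.E // Fused S S' h p.1 p.2} ⊕
    {e' : S'.E // (S'.src e').isRight}
  finC := by
    have := S.finC
    have := S'.finC
    infer_instance
  finE := by
    have := S.finE
    have := S'.finE
    infer_instance
  src
    | .inl e => (S.src e.1).map id .inl
    | .inr (.inl p) => (S.src p.1.1).map id .inl
    | .inr (.inr e') => .inr (.inr ((S'.src e'.1).getRight e'.2))
  tgt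
    | .inl e => .inl (.inl ((S.tgt e.1).getLeft e.2))
    | .inr (.inl p) => (S'.tgt p.1.2).map .inr id
    | .inr (.inr e') => (S'.tgt e'.1).map .inr id
  label := Sum.elim S.label S'.label
  in_unique := by
    intro i
    obtain ⟨e, he, hu⟩ := S.in_unique i
    have hsrc : ∀ x, Sum.map id (Sum.inl : S.C → S.C ⊕ S'.C) x = .inl i → x = .inl i := by
      rintro (x | x) hx <;> simp_all
    rcases ht : S.tgt e with v | j
    · refine ⟨.inl ⟨e, by simp [ht]⟩, by simp [he], ?_⟩
      rintro (⟨f, hf'⟩ | ⟨⟨f, f'⟩, j, hj, hj'⟩ | f) hf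
      · obtain rfl := hu f (hsrc _ hf)
        rfl
      · obtain rfl := hu f (hsrc _ hf)
        simp [ht] at hj
      · simp at hf
    · obtain ⟨e', he', hu'⟩ := S'.in_unique (j.cast h)
      refine ⟨.inr (.inl ⟨(e, e'), j, ht, he'⟩), by simp [he], ?_⟩
      rintro (⟨f, hf'⟩ | ⟨⟨f, f'⟩, k, hk, hk'⟩ | f) hf
      · obtain rfl := hu f (hsrc _ hf)
        simp [ht] at hf'
      · obtain rfl := hu f (hsrc _ hf)
        dsimp only at hk hk'
        rw [ht, Sum.inr.injEq] at hk
        subst hk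
        obtain rfl := hu' f' hk'
        rfl
      · simp at hf
  out_unique := by
    intro i
    obtain ⟨e', he', hu'⟩ := S'.out_unique i
    have htgt : ∀ x, Sum.map (Sum.inr : S'.C → S.C ⊕ S'.C) id x = .inr i → x = .inr i := by
      rintro (x | x) hx <;> simp_all
    rcases hs : S'.src e' with j | v
    · obtain ⟨e, he, hu⟩ := S.out_unique (j.cast h.symm)
      refine ⟨.inr (.inl ⟨(e, e'), j.cast h.symm, he, by simpa using hs⟩), by simp [he'], ?_⟩
      rintro (f | ⟨⟨f, f'⟩, k, hk, hk'⟩ | ⟨f, hf'⟩) hf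
      · simp at hf
      · obtain rfl := hu' f' (htgt _ hf)
        dsimp only at hk hk'
        rw [hs, Sum.inl.injEq] at hk'
        subst hk'
        obtain rfl := hu f (by simpa using hk)
        rfl
      · obtain rfl := hu' f (htgt _ hf)
        simp [hs] at hf'
    · refine ⟨.inr (.inr ⟨e', by simp [hs]⟩), by simp [he'], ?_⟩
      rintro (f | ⟨⟨f, f'⟩, k, hk, hk'⟩ | ⟨f, hf'⟩) hf
      · simp at hf
      · obtain rfl := hu' f' (htgt _ hf)
        simp [hs] at hk'
      · obtain rfl := hu' f (htgt _ hf)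
        rfl
  acyclic := by
    refine acyclic_sum _ _ _ S.acyclic S'.acyclic ?_ ?_ ?_
    · rintro a b ⟨e | ⟨⟨e, e'⟩, i, hi⟩ | e, h1, h2⟩
      · refine ⟨e.1, ?_, ?_⟩
        · rcases hs : S.src e.1 with x | x <;> simp_all
        · rcases ht : S.tgt e.1 with x | x
          · simp_all
          · have := e.2
            simp [ht] at this
      · rcases ht : S'.tgt e' with x | x <;> simp_all
      · simp at h1
    · rintro a b ⟨e | ⟨⟨e, e'⟩, i, hi⟩ | e, h1, h2⟩
      · simp at h2
      · rcases hs : S.src e with x | x <;> simp_all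
      · refine ⟨e.1, ?_, ?_⟩
        · rcases hs : S'.src e.1 with x | x
          · have := e.2
            simp [hs] at this
          · simp_all
        · rcases ht : S'.tgt e.1 with x | x <;> simp_all
    · rintro a b ⟨e | ⟨⟨e, e'⟩, i, hi⟩ | e, h1, h2⟩
      · rcases hs : S.src e.1 with x | x <;> simp_all
      · rcases hs : S.src e with x | x <;> simp_all
      · rcases ht : S'.tgt e.1 with x | x <;> simp_all

/-- The DAG on the center vertices; edges touching a frontier are disregarded (there are none when
both frontiers are empty). -/
def toLDAG (S : Slice T) : LDAG T where
  V := S.C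
  E := {p : S.E × S.C × S.C // S.src p.1 = .inr p.2.1 ∧ S.tgt p.1 = .inl p.2.2}
  finV := S.finC
  finE := by
    have := S.finC
    have := S.finE
    infer_instance
  src := fun p => p.1.2.1
  tgt := fun p => p.1.2.2
  label := S.label
  acyclic := by
    intro v hv
    refine S.acyclic v (TransGen.mono ?_ _ _ hv)
    rintro a b ⟨⟨⟨e, x, y⟩, h1, h2⟩, rfl, rfl⟩
    exact ⟨e, h1, h2⟩

end Slice

/-- A unit slice up to isomorphism, with center vertex labelled by `label`: an in-frontier vertex
`i` with `pass i = some j` is joined to the out-frontier vertex `j`, every other in-frontier vertex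
is joined to the center, and the center is joined to every remaining out-frontier vertex. -/
structure UnitSlice (T : Type u) where
  inn : ℕ
  out : ℕ
  label : T
  pass : Fin inn ≃. Fin out

namespace UnitSlice

variable {T : Type u}

/-- The slice described by a `UnitSlice`. -/
def toSlice (S : UnitSlice T) : Slice T where
  inn := S.inn
  out := S.out
  C := Unit
  E := Fin S.inn ⊕ {j : Fin S.out // S.pass.symm j = none}
  finC := inferInstance
  finE := inferInstance
  src
    | .inl i => .inl i
    | .inr _ => .inr ()
  tgt
    | .inl i => match S.pass i with
      | some j => .inr j
      | none => .inl ()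
    | .inr j => .inr j.1
  label := fun _ => S.label
  in_unique := by
    intro i
    refine ⟨.inl i, rfl, ?_⟩
    rintro (k | k) hk
    · simpa using hk
    · simp at hk
  out_unique := by
    intro j
    rcases hj : S.pass.symm j with - | i
    · refine ⟨.inr ⟨j, hj⟩, rfl, ?_⟩
      rintro (k | k) hk
      · rcases hp : S.pass k with - | j'
        · simp [hp] at hk
        · simp only [hp, Sum.inr.injEq] at hk
          subst hk
          have := (PEquiv.eq_some_iff S.pass).2 hp
          simp_all
      · simp only [Sum.inr.injEq] at hk
        subst hk
        rfl
    · have hi := (PEquiv.eq_some_iff S.pass).1 hj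
      refine ⟨.inl i, by simp [hi], ?_⟩
      rintro (k | k) hk
      · rcases hp : S.pass k with - | j'
        · simp [hp] at hk
        · simp only [hp, Sum.inr.injEq] at hk
          subst hk
          have := (PEquiv.eq_some_iff S.pass).2 hp
          simp_all
      · simp only [Sum.inr.injEq] at hk
        subst hk
        have := k.2
        simp_all
  acyclic := by
    intro v hv
    obtain ⟨c, -, e | e, h1, h2⟩ := TransGen.tail'_iff.1 hv
    · simp at h1
    · simp at h2

def width (S : UnitSlice T) : ℕ := max S.inn S.out

end UnitSlice

/-- The slice alphabet `Σ(c, T)`. -/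
def sliceAlphabet (c : ℕ) (T : Type u) : Set (UnitSlice T) := {S | S.width ≤ c}

/-- A unit decomposition over an arbitrary width: a sequence of consecutively composable unit
slices whose first slice is initial and whose last slice is final. -/
structure IsUnitDecomposition {T : Type u} (U : List (UnitSlice T)) : Prop where
  chain : U.IsChain fun S S' => S.out = S'.inn
  initial : ∀ S ∈ U.head?, S.inn = 0
  final : ∀ S ∈ U.getLast?, S.out = 0

/-- `S₁ ∘ S₂ ∘ ⋯ ∘ Sₙ`, for composable sequences ending in a final slice. -/
def composedSlice {T : Type u} : List (UnitSlice T) → Slice T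
  | [] => Slice.empty
  | S :: U =>
    if h : S.out = (composedSlice U).inn then S.toSlice.glue (composedSlice U) h else Slice.empty

/-- The DAG obtained from a unit decomposition by composing its slices. -/
def composed {T : Type u} (U : List (UnitSlice T)) : LDAG T := (composedSlice U).toLDAG

/-- The set of all unit decompositions over `Σ(c, T)`. -/
def unitDecompositions (c : ℕ) (T : Type u) : Set (List (UnitSlice T)) :=
  {U | (∀ S ∈ U, S ∈ sliceAlphabet c T) ∧ IsUnitDecomposition U}

/-- The unit decompositions of width at most `c` of the DAG `H` (up to isomorphism). -/
def udWidth {T : Type u} (H : LDAG T) (c : ℕ) : Set (List (UnitSlice T)) :=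
  {U ∈ unitDecompositions c T | Nonempty ((composed U).Iso H)}

/-- The set of all unit decompositions of `H`. -/
def ud {T : Type u} (H : LDAG T) : Set (List (UnitSlice T)) := ⋃ c, udWidth H c

/-! ### Slice languages -/

/-- The DAGs represented by a slice language (closed under isomorphism). -/
def graphLanguage {T : Type u} (L : Set (List (UnitSlice T))) : Set (LDAG T) :=
  {H | ∃ U ∈ L, Nonempty ((composed U).Iso H)}

/-- The partial orders represented by a slice language (closed under isomorphism). -/
def poLanguage {T : Type u} (L : Set (List (UnitSlice T))) : Set (LPO T) :=
  {ℓ | ∃ U ∈ L, (composed U).tc.IsIso ℓ}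

def IsSaturatedLanguage {T : Type u} (L : Set (List (UnitSlice T))) : Prop :=
  ∀ H ∈ graphLanguage L, ud H ⊆ L

def IsTransReducedLanguage {T : Type u} (L : Set (List (UnitSlice T))) : Prop :=
  ∀ H ∈ graphLanguage L, H.IsTransReduced

/-- A slice automaton over `Σ(c, T)`. -/
structure SliceAutomaton (c : ℕ) (T : Type u) where
  Q : Type
  finQ : Finite Q
  Δ : Set (Q × UnitSlice T × Q)
  q₀ : Q
  F : Set Q
  alphabet : ∀ q S q', (q, S, q') ∈ Δ → S ∈ sliceAlphabet c T
  initial : ∀ S q, (q₀, S, q) ∈ Δ → S.inn = 0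
  final : ∀ q S q', (q, S, q') ∈ Δ → q' ∈ F → S.out = 0
  glue : ∀ q S q' S' q'', (q, S, q') ∈ Δ → (q', S', q'') ∈ Δ → S.out = S'.inn

namespace SliceAutomaton

variable {T : Type u} {c : ℕ}

/-- The underlying nondeterministic automaton. -/
def toNFA (A : SliceAutomaton c T) : NFA (UnitSlice T) A.Q where
  step := fun q S => {q' | (q, S, q') ∈ A.Δ}
  start := {A.q₀}
  accept := A.F

/-- The slice language accepted by a slice automaton. -/
def lang (A : SliceAutomaton c T) : Set (List (UnitSlice T)) := {U | U ∈ A.toNFA.accepts}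

def IsSaturated (A : SliceAutomaton c T) : Prop := IsSaturatedLanguage A.lang

def IsTransReduced (A : SliceAutomaton c T) : Prop := IsTransReducedLanguage A.lang

/-- `A` is a slice automaton `𝒜(c, T, ψ)`: it accepts exactly the unit decompositions over
`Σ(c, T)` whose composed DAG satisfies `ψ`. -/
def Defines (A : SliceAutomaton c T) (ψ : MSO₂Sentence T) : Prop :=
  A.lang = {U ∈ unitDecompositions c T | (composed U).Models ψ}

end SliceAutomaton

/-- `𝒫(c, T, φ)`: the `T`-labelled partial orders satisfying `φ` whose Hasse diagram can be covered
by `c` paths. -/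
def cPartialOrders (c : ℕ) (T : Type u) (φ : MSOSentence T) : Set (LPO T) :=
  {ℓ | ℓ.hasse.CoverableBy c ∧ ℓ.Models φ}

/-! ### Truth of the derived connectives -/

namespace MSO₂

variable {T : Type u} {n m p q : ℕ} (H : LDAG T) (xs : Fin n → H.V) (ys : Fin m → H.E)
  (Xs : Fin p → Set H.V) (Ys : Fin q → Set H.E)

/-! The central fact is a count: along a unit decomposition every edge goes forward, so a path
crosses each cut between consecutive slices at most once. A DAG that is a union of `c` paths has at
most `c` edges across any cut, so all its unit decompositions have width at most `c`
(`IsUnitDecomposition.mem_sliceAlphabet`). Thus `gamma c` already implies the width bound, and the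
automaton accepts all unit decompositions, of any width, of the models. Saturation follows because
truth is invariant under isomorphism (`LDAG.Iso.sat_iff`).

On the side of orders, Hasse diagrams are transitively reduced, and a transitively reduced DAG is
the Hasse diagram of its transitive closure (`LDAG.IsTransReduced.iso_hasse_tc`). Every Hasse
diagram is reached, since a topological ordering yields a unit decomposition
(`LDAG.exists_isUnitDecomposition`). The meaning of the three sentences reduces to that of `path`:
in a finite DAG its local conditions leave room for a single path only, because any further
component would contain a cycle (`LDAG.PathConditions.isPathFromTo`).

The automaton comes from Büchi's argument (`MSO₂.recognizable`). An edge is named by the slice where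
it starts and the out-frontier vertex through which it leaves, so an assignment becomes a marking of
the letters, and connectives and quantifiers become Boolean operations and projections of regular
languages. Only the target atom compares different slices. Read from right to left, it is decided by
remembering which of the at most `c` frontier vertices lead to the marked vertex
(`foldr_targetStep`). `Layout` fixes this naming, so that the recursive gluing has to be analysed
only once, in `SliceLayout.nonempty_glue`. -/

theorem sat_imp (φ ψ : MSO₂ T n m p q) :
    (imp φ ψ).Sat H xs ys Xs Ys ↔ (φ.Sat H xs ys Xs Ys → ψ.Sat H xs ys Xs Ys) := by
  simp only [imp, Sat]
  tauto

theorem sat_allV (φ : MSO₂ T (n + 1) m p q) :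
    (allV φ).Sat H xs ys Xs Ys ↔ ∀ v, φ.Sat H (Matrix.vecCons v xs) ys Xs Ys := by
  simp [allV, Sat]

theorem sat_allE (φ : MSO₂ T n (m + 1) p q) :
    (allE φ).Sat H xs ys Xs Ys ↔ ∀ e, φ.Sat H xs (Matrix.vecCons e ys) Xs Ys := by
  simp [allE, Sat]

theorem sat_eqV (x x' : Fin n) :
    (eqV x x' : MSO₂ T n m p q).Sat H xs ys Xs Ys ↔ xs x = xs x' := by
  simp only [eqV, Sat, Matrix.cons_val_zero, not_exists, not_and, not_not]
  exact ⟨fun h => (h {xs x} rfl).symm, fun h A hA => h ▸ hA⟩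

theorem sat_eqE (y y' : Fin m) :
    (eqE y y' : MSO₂ T n m p q).Sat H xs ys Xs Ys ↔ ys y = ys y' := by
  simp only [eqE, Sat, Matrix.cons_val_zero, not_exists, not_and, not_not]
  exact ⟨fun h => (h {ys y} rfl).symm, fun h A hA => h ▸ hA⟩

theorem not_sat_fls : ¬ (fls : MSO₂ T n m p q).Sat H xs ys Xs Ys := by
  simp [fls, Sat]

theorem sat_bigAnd {c : ℕ} (φ : Fin c → MSO₂ T n m p q) :
    (bigAnd φ).Sat H xs ys Xs Ys ↔ ∀ i, (φ i).Sat H xs ys Xs Ys := by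
  have key : ∀ L : List (MSO₂ T n m p q),
      (L.foldr (β := MSO₂ T n m p q) .and (.not fls)).Sat H xs ys Xs Ys ↔ ∀ ψ ∈ L, ψ.Sat H xs ys Xs Ys := by
    intro L
    induction L with
    | nil => simpa [Sat] using not_sat_fls H xs ys Xs Ys
    | cons ψ L ih => simp [Sat, ih]
  rw [bigAnd, key, List.forall_mem_ofFn_iff]

theorem sat_bigOr {c : ℕ} (φ : Fin c → MSO₂ T n m p q) :
    (bigOr φ).Sat H xs ys Xs Ys ↔ ∃ i, (φ i).Sat H xs ys Xs Ys := by
  have key : ∀ L : List (MSO₂ T n m p q),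
      (L.foldr (β := MSO₂ T n m p q) .or fls).Sat H xs ys Xs Ys ↔ ∃ ψ ∈ L, ψ.Sat H xs ys Xs Ys := by
    intro L
    induction L with
    | nil => simpa [Sat] using not_sat_fls H xs ys Xs Ys
    | cons ψ L ih => simp [Sat, ih]
  rw [bigOr, key]
  simp [List.mem_ofFn]

theorem sat_exVSs (φ : MSO₂ T n m p q) (Xs : Fin 0 → Set H.V) :
    (exVSs p φ).Sat H xs ys Xs Ys ↔ ∃ Xs', φ.Sat H xs ys Xs' Ys := by
  induction p with
  | zero => exact ⟨fun h => ⟨_, h⟩, fun ⟨Xs', h⟩ => by rwa [Subsingleton.elim Xs Xs']⟩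
  | succ p ih =>
    rw [exVSs, ih]
    simp only [Sat]
    exact ⟨fun ⟨Xs', A, h⟩ => ⟨_, h⟩, fun ⟨Xs', h⟩ => ⟨Matrix.vecTail Xs', Matrix.vecHead Xs', by
      rwa [Matrix.cons_head_tail]⟩⟩

theorem sat_exESs (φ : MSO₂ T n m p q) (Ys : Fin 0 → Set H.E) :
    (exESs q φ).Sat H xs ys Xs Ys ↔ ∃ Ys', φ.Sat H xs ys Xs Ys' := by
  induction q with
  | zero => exact ⟨fun h => ⟨_, h⟩, fun ⟨Ys', h⟩ => by rwa [Subsingleton.elim Ys Ys']⟩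
  | succ q ih =>
    rw [exESs, ih]
    simp only [Sat]
    exact ⟨fun ⟨Ys', A, h⟩ => ⟨_, h⟩, fun ⟨Ys', h⟩ => ⟨Matrix.vecTail Ys', Matrix.vecHead Ys', by
      rwa [Matrix.cons_head_tail]⟩⟩

end MSO₂

/-! ### Paths in DAGs -/

namespace LDAG

variable {T : Type u} (H : LDAG T)

/-- The local conditions expressed by the formula `MSO₂.path`. -/
structure PathConditions (a b : H.V) (X : Set H.V) (Y : Set H.E) : Prop where
  start_mem : a ∈ X
  end_mem : b ∈ X
  src_mem : ∀ e ∈ Y, H.src e ∈ X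
  tgt_mem : ∀ e ∈ Y, H.tgt e ∈ X
  src_inj : ∀ e ∈ Y, ∀ e' ∈ Y, H.src e = H.src e' → e = e'
  tgt_inj : ∀ e ∈ Y, ∀ e' ∈ Y, H.tgt e = H.tgt e' → e = e'
  exists_out : ∀ v ∈ X, v ≠ b → ∃ e ∈ Y, H.src e = v
  exists_in : ∀ v ∈ X, v ≠ a → ∃ e ∈ Y, H.tgt e = v
  tgt_ne : ∀ e ∈ Y, H.tgt e ≠ a
  src_ne : ∀ e ∈ Y, H.src e ≠ b

theorem sat_path_iff_pathConditions {n m p q : ℕ} (xs : Fin n → H.V) (ys : Fin m → H.E)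
    (Xs : Fin p → Set H.V) (Ys : Fin q → Set H.E) (x x' : Fin n) (X : Fin p) (Y : Fin q) :
    (MSO₂.path x x' X Y).Sat H xs ys Xs Ys ↔
      H.PathConditions (xs x) (xs x') (Xs X) (Ys Y) := by
  simp only [MSO₂.path, MSO₂.Sat, MSO₂.sat_allE, MSO₂.sat_allV, MSO₂.sat_imp, MSO₂.sat_eqV,
    MSO₂.sat_eqE, Matrix.cons_val_zero, Matrix.cons_val_one, Matrix.cons_val_succ]
  constructor
  · rintro ⟨⟨h1, h2⟩, h3, h4, h5, h6, h7⟩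
    refine ⟨h1, h2, fun e he => h3 e _ ⟨he, .inl rfl⟩, fun e he => h3 e _ ⟨he, .inr rfl⟩,
      -- The inner of the two edge quantifiers binds variable `0`, hence the reversed order of the
      -- arguments.
      fun e he e' he' h => h4 e' e _ ⟨⟨he, he'⟩, .inl ⟨h, rfl⟩⟩,
      fun e he e' he' h => h4 e' e _ ⟨⟨he, he'⟩, .inr ⟨h, rfl⟩⟩,
      fun v hv hb => (h5 v hv).resolve_left hb, fun v hv hb => (h6 v hv).resolve_left hb,
      fun e he h => h7 ⟨e, he, .inl h⟩, fun e he h => h7 ⟨e, he, .inr h⟩⟩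
  · intro h
    refine ⟨⟨h.1, h.2⟩, ?_, ?_, fun v hv => or_iff_not_imp_left.2 (h.exists_out v hv),
      fun v hv => or_iff_not_imp_left.2 (h.exists_in v hv), ?_⟩
    · rintro e v ⟨he, rfl | rfl⟩
      exacts [h.src_mem e he, h.tgt_mem e he]
    · rintro e e' v ⟨⟨he, he'⟩, ⟨h1, h2⟩ | ⟨h1, h2⟩⟩
      exacts [h.src_inj _ he _ he' (h1.trans h2.symm), h.tgt_inj _ he _ he' (h1.trans h2.symm)]
    · rintro ⟨e, he, h1 | h1⟩
      exacts [h.tgt_ne e he h1, h.src_ne e he h1]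

/-! ### Walks in finite acyclic graphs -/

theorem adj_edge (e : H.E) : H.Adj (H.src e) (H.tgt e) := ⟨e, rfl, rfl⟩

/-- Acyclicity and finiteness permit induction along edges in both directions. Forward search builds
the path out of `PathConditions`, and backward search shows that it exhausts the vertex set. -/
theorem wellFounded_transGen : WellFounded (TransGen H.Adj) := by
  have := H.finV
  have : Std.Irrefl (TransGen H.Adj) := ⟨H.acyclic⟩
  exact Finite.wellFounded_of_trans_of_irrefl _

theorem wellFounded_transGen_swap : WellFounded (Function.swap (TransGen H.Adj)) := by
  have := H.finV
  have : Std.Irrefl (Function.swap (TransGen H.Adj)) := ⟨H.acyclic⟩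
  have : IsTrans _ (Function.swap (TransGen H.Adj)) := ⟨fun _ _ _ h h' => h'.trans h⟩
  exact Finite.wellFounded_of_trans_of_irrefl _

theorem wellFounded_adj : WellFounded H.Adj :=
  Subrelation.wf (fun h => TransGen.single h) H.wellFounded_transGen

theorem wellFounded_adj_swap : WellFounded (Function.swap H.Adj) :=
  Subrelation.wf (r := Function.swap (TransGen H.Adj)) (fun h => TransGen.single h)
    H.wellFounded_transGen_swap

theorem transGen_of_walk {k : ℕ} (v : Fin (k + 1) → H.V) (F : Set H.E) (e : Fin k → H.E)
    (hF : ∀ i, e i ∈ F)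
    (he : ∀ i, H.src (e i) = v i.castSucc ∧ H.tgt (e i) = v i.succ) {i j : Fin (k + 1)}
    (hij : i < j) : TransGen (H.AdjOn F) (v i) (v j) := by
  induction j using Fin.induction with
  | zero => simp at hij
  | succ j ih =>
    have step : H.AdjOn F (v j.castSucc) (v j.succ) := ⟨e j, hF j, he j⟩
    rcases (Fin.le_castSucc_iff.2 hij).eq_or_lt with h | h
    · rw [h]; exact .single step
    · exact (ih h).tail step

theorem adjOn_le (F : Set H.E) {a b : H.V} (h : H.AdjOn F a b) : H.Adj a b := by
  obtain ⟨e, -, h⟩ := h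
  exact ⟨e, h⟩

theorem transGen_adjOn_le (F : Set H.E) {a b : H.V} (h : TransGen (H.AdjOn F) a b) :
    TransGen H.Adj a b := TransGen.mono (fun _ _ => H.adjOn_le F) _ _ h

/-- A repeated vertex would close a cycle, so simplicity of paths is automatic in a DAG. -/
theorem walk_injective {k : ℕ} (v : Fin (k + 1) → H.V) (e : Fin k → H.E)
    (he : ∀ i, H.src (e i) = v i.castSucc ∧ H.tgt (e i) = v i.succ) : Function.Injective v := by
  have key : ∀ i j, i < j → v i ≠ v j := by
    intro i j hij h
    have h1 := H.transGen_adjOn_le _ (H.transGen_of_walk v Set.univ e (fun _ => trivial) he hij)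
    rw [h] at h1
    exact H.acyclic _ h1
  intro i j h
  rcases lt_trichotomy i j with h' | h' | h'
  exacts [(key _ _ h' h).elim, h', (key _ _ h' h.symm).elim]

theorem IsPathFromTo.pathConditions {a b : H.V} {X : Set H.V} {Y : Set H.E}
    (h : H.IsPathFromTo a b X Y) : H.PathConditions a b X Y := by
  obtain ⟨k, v, e, hv, he, rfl, rfl, rfl, rfl⟩ := h
  refine ⟨⟨_, rfl⟩, ⟨_, rfl⟩, ?_, ?_, ?_, ?_, ?_, ?_, ?_, ?_⟩
  · rintro _ ⟨i, rfl⟩; exact ⟨_, (he i).1.symm⟩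
  · rintro _ ⟨i, rfl⟩; exact ⟨_, (he i).2.symm⟩
  · rintro _ ⟨i, rfl⟩ _ ⟨j, rfl⟩ h
    rw [(he i).1, (he j).1] at h
    rw [Fin.castSucc_injective _ (hv h)]
  · rintro _ ⟨i, rfl⟩ _ ⟨j, rfl⟩ h
    rw [(he i).2, (he j).2] at h
    rw [Fin.succ_injective _ (hv h)]
  · rintro _ ⟨i, rfl⟩ h
    rcases Fin.eq_castSucc_or_eq_last i with ⟨i, rfl⟩ | rfl
    · exact ⟨_, ⟨i, rfl⟩, (he i).1⟩
    · exact (h rfl).elim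
  · rintro _ ⟨i, rfl⟩ h
    rcases Fin.eq_zero_or_eq_succ i with rfl | ⟨i, rfl⟩
    · exact (h rfl).elim
    · exact ⟨_, ⟨i, rfl⟩, (he i).2⟩
  · rintro _ ⟨i, rfl⟩ h
    rw [(he i).2] at h
    exact Fin.succ_ne_zero _ (hv h)
  · rintro _ ⟨i, rfl⟩ h
    rw [(he i).1] at h
    exact (Fin.castSucc_lt_last i).ne (hv h)

/-- Leaving `a` along edges of `Y` one can stop only at `b`, and acyclicity forces a stop. Nothing
lies off this walk: going back from any vertex of `X` along edges of `Y` one ends at `a`, and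
uniqueness of outgoing edges brings one back along the walk. -/
theorem PathConditions.isPathFromTo {a b : H.V} {X : Set H.V} {Y : Set H.E}
    (h : H.PathConditions a b X Y) : H.IsPathFromTo a b X Y := by
  have key : ∀ a ∈ X, ∃ (k : ℕ) (v : Fin (k + 1) → H.V) (e : Fin k → H.E),
      (∀ i, H.src (e i) = v i.castSucc ∧ H.tgt (e i) = v i.succ) ∧ (∀ i, e i ∈ Y) ∧
      v 0 = a ∧ v (Fin.last k) = b := by
    intro a
    induction a using H.wellFounded_adj_swap.induction with
    | h a ih =>
      intro ha
      by_cases hb : a = b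
      · exact ⟨0, fun _ => a, Fin.elim0, fun i => i.elim0, fun i => i.elim0, rfl, hb⟩
      · obtain ⟨e₀, he₀, rfl⟩ := h.exists_out a ha hb
        obtain ⟨k, v, e, h1, h2, h3, h4⟩ := ih _ (H.adj_edge e₀) (h.tgt_mem _ he₀)
        refine ⟨k + 1, Fin.cons (H.src e₀) v, Fin.cons e₀ e, ?_, ?_, rfl, ?_⟩
        · intro i
          cases i using Fin.cases with
          | zero => simp [h3]
          | succ i => simpa [Fin.castSucc_succ] using h1 i
        · intro i
          cases i using Fin.cases with
          | zero => simpa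
          | succ i => simpa using h2 i
        · rw [← Fin.succ_last, Fin.cons_succ, h4]
  obtain ⟨k, v, e, he, hY, h0, hl⟩ := key a h.start_mem
  have hX : X = Set.range v := by
    apply Set.Subset.antisymm
    -- Induction on predecessors: the edge entering `x` starts on the walk, where it must be the
    -- next edge of the walk.
    · intro x
      induction x using H.wellFounded_adj.induction with
      | h x ih =>
        intro hx
        by_cases hxa : x = a
        · exact ⟨0, by rw [h0, hxa]⟩
        · obtain ⟨e₀, he₀, rfl⟩ := h.exists_in x hx hxa
          obtain ⟨i, hi⟩ := ih _ (H.adj_edge e₀) (h.src_mem _ he₀)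
          rcases Fin.eq_castSucc_or_eq_last i with ⟨i, rfl⟩ | rfl
          · refine ⟨i.succ, ?_⟩
            rw [← (he i).2, h.src_inj (e i) (hY i) e₀ he₀ ((he i).1.trans hi)]
          · exact (h.src_ne _ he₀ (hi.symm.trans hl)).elim
    · rintro _ ⟨i, rfl⟩
      rcases Fin.eq_castSucc_or_eq_last i with ⟨i, rfl⟩ | rfl
      · rw [← (he i).1]; exact h.src_mem _ (hY i)
      · rw [hl]; exact h.end_mem
  refine ⟨k, v, e, H.walk_injective v e he, he, h0, hl, hX, ?_⟩
  apply Set.Subset.antisymm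
  · intro e₀ he₀
    obtain ⟨i, hi⟩ := hX ▸ h.src_mem _ he₀
    rcases Fin.eq_castSucc_or_eq_last i with ⟨i, rfl⟩ | rfl
    · exact ⟨i, h.src_inj _ (hY i) _ he₀ ((he i).1.trans hi)⟩
    · exact (h.src_ne _ he₀ (hi.symm.trans hl)).elim
  · rintro _ ⟨i, rfl⟩
    exact hY i

theorem sat_path {n m p q : ℕ} (xs : Fin n → H.V) (ys : Fin m → H.E)
    (Xs : Fin p → Set H.V) (Ys : Fin q → Set H.E) (x x' : Fin n) (X : Fin p) (Y : Fin q) :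
    (MSO₂.path x x' X Y).Sat H xs ys Xs Ys ↔
      H.IsPathFromTo (xs x) (xs x') (Xs X) (Ys Y) :=
  (H.sat_path_iff_pathConditions ..).trans
    ⟨PathConditions.isPathFromTo H, IsPathFromTo.pathConditions H⟩

theorem exists_walk_of_reflTransGen (F : Set H.E) {a b : H.V}
    (h : ReflTransGen (H.AdjOn F) a b) : ∃ (k : ℕ) (v : Fin (k + 1) → H.V) (e : Fin k → H.E),
      (∀ i, H.src (e i) = v i.castSucc ∧ H.tgt (e i) = v i.succ) ∧ (∀ i, e i ∈ F) ∧
      v 0 = a ∧ v (Fin.last k) = b := by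
  induction h using ReflTransGen.head_induction_on with
  | refl => exact ⟨0, fun _ => b, Fin.elim0, fun i => i.elim0, fun i => i.elim0, rfl, rfl⟩
  | head h _ ih =>
    obtain ⟨e₀, he₀, rfl, ht⟩ := h
    obtain ⟨k, v, e, h1, h2, h3, h4⟩ := ih
    refine ⟨k + 1, Fin.cons (H.src e₀) v, Fin.cons e₀ e, ?_, ?_, rfl, ?_⟩
    · intro i
      cases i using Fin.cases with
      | zero => simp [h3, ht]
      | succ i => simpa [Fin.castSucc_succ] using h1 i
    · intro i
      cases i using Fin.cases with
      | zero => simpa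
      | succ i => simpa using h2 i
    · rw [← Fin.succ_last, Fin.cons_succ, h4]

/-- Some path from `a` to `b` uses edges of `F` only if and only if `b` can be reached from `a`
along `F`. -/
theorem exists_isPathFromTo_iff (F : Set H.E) (a b : H.V) :
    (∃ X Y, H.IsPathFromTo a b X Y ∧ Y ⊆ F) ↔ ReflTransGen (H.AdjOn F) a b := by
  constructor
  · rintro ⟨X, Y, ⟨k, v, e, hv, he, rfl, rfl, rfl, rfl⟩, hF⟩
    rcases (Fin.zero_le (Fin.last k)).eq_or_lt with h | h
    · rw [← h]
    · exact (H.transGen_of_walk v F e (fun i => hF ⟨i, rfl⟩) he h).to_reflTransGen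
  · intro h
    obtain ⟨k, v, e, h1, h2, h3, h4⟩ := H.exists_walk_of_reflTransGen F h
    exact ⟨_, _, ⟨k, v, e, H.walk_injective v e h1, h1, h3, h4, rfl, rfl⟩,
      Set.range_subset_iff.2 h2⟩

theorem adjOn_univ : H.AdjOn Set.univ = H.Adj := by
  ext a b
  simp [AdjOn, Adj]

theorem ne_of_transGen {a b : H.V} (h : TransGen H.Adj a b) : a ≠ b := by
  rintro rfl
  exact H.acyclic _ h

/-- The inequality excludes exactly the one-vertex path; conversely acyclicity makes the ends of a
nontrivial path distinct. -/
theorem exists_isPathFromTo_and_ne_iff (a b : H.V) :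
    (∃ X Y, H.IsPathFromTo a b X Y ∧ a ≠ b) ↔ TransGen H.Adj a b := by
  have := H.exists_isPathFromTo_iff Set.univ a b
  simp only [Set.subset_univ, and_true, adjOn_univ] at this
  constructor
  · rintro ⟨X, Y, h, hne⟩
    exact (reflTransGen_iff_eq_or_transGen.1 (this.1 ⟨X, Y, h⟩)).resolve_left hne.symm
  · intro h
    obtain ⟨X, Y, h'⟩ := this.2 h.to_reflTransGen
    exact ⟨X, Y, h', H.ne_of_transGen h⟩

theorem sat_gr_lt {n p : ℕ} (xs : Fin n → H.V) (Xs : Fin p → Set H.V) (x y : Fin n) :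
    (MSO.lt x y : MSO T n p).gr.Sat H xs ![] Xs ![] ↔ TransGen H.Adj (xs x) (xs y) := by
  simp only [MSO.gr, MSO₂.Sat, sat_path, MSO₂.sat_eqV, Matrix.cons_val_zero]
  exact H.exists_isPathFromTo_and_ne_iff (xs x) (xs y)

/-! ### Transitive reduction and coverability -/

/-- Each use of `e` is replaced by the bypass, which has at least one edge because the ends of `e`
differ. -/
theorem transGen_adjOn_of_bypass (e : H.E)
    (h : ReflTransGen (H.AdjOn {e}ᶜ) (H.src e) (H.tgt e)) {u v : H.V}
    (huv : TransGen H.Adj u v) : TransGen (H.AdjOn {e}ᶜ) u v := by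
  have step : ∀ a b, H.Adj a b → TransGen (H.AdjOn {e}ᶜ) a b := by
    rintro a b ⟨e', rfl, rfl⟩
    by_cases he : e' = e
    · subst he
      exact (reflTransGen_iff_eq_or_transGen.1 h).resolve_left
        (H.ne_of_transGen (.single (H.adj_edge e'))).symm
    · exact .single ⟨e', he, rfl, rfl⟩
  induction huv with
  | single h => exact step _ _ h
  | tail _ h ih => exact ih.trans (step _ _ h)

/-- It suffices to delete single edges: an edge missing from a subgraph with the same closure is
bypassed inside that subgraph. This is the form that `rho` expresses. -/
theorem isTransReduced_iff :
    H.IsTransReduced ↔ ∀ e, ¬ ReflTransGen (H.AdjOn {e}ᶜ) (H.src e) (H.tgt e) := by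
  constructor
  · intro h e he
    have := h {e}ᶜ fun u v => ⟨H.transGen_adjOn_le _, H.transGen_adjOn_of_bypass e he⟩
    have : e ∈ ({e}ᶜ : Set H.E) := this ▸ trivial
    exact this rfl
  · intro h F hF
    by_contra hne
    obtain ⟨e, he⟩ := (Set.ne_univ_iff_exists_notMem F).1 hne
    refine h e (TransGen.to_reflTransGen (TransGen.mono ?_ _ _
      ((hF _ _).2 (.single (H.adj_edge e)))))
    rintro a b ⟨e', he', h⟩
    exact ⟨e', fun h' => he (h' ▸ he'), h⟩

theorem models_rho_iff : H.Models MSO₂.rho ↔ H.IsTransReduced := by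
  simp only [LDAG.Models, MSO₂.rho, MSO₂.Sat, sat_path, H.isTransReduced_iff,
    ← H.exists_isPathFromTo_iff, Set.subset_compl_singleton_iff, not_exists]
  constructor
  · intro h e X Y hXY
    exact h e (H.tgt e) (H.src e) ⟨⟨rfl, rfl⟩, X, Y, hXY⟩
  · rintro h e a b ⟨⟨h1, h2⟩, X, Y, hXY⟩
    refine h e X Y ?_
    simp only [Matrix.cons_val_zero, Matrix.cons_val_one] at h1 h2 hXY
    rwa [h1, h2]

theorem models_gamma_iff (c : ℕ) : H.Models (MSO₂.gamma c) ↔ H.CoverableBy c := by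
  simp only [LDAG.Models, MSO₂.gamma, MSO₂.sat_exVSs, MSO₂.sat_exESs, MSO₂.Sat, MSO₂.sat_bigAnd,
    sat_path, MSO₂.sat_allV, MSO₂.sat_bigOr, MSO₂.sat_allE, Matrix.cons_val_zero,
    Matrix.cons_val_one, LDAG.CoverableBy, LDAG.IsPath]
  constructor
  · rintro ⟨X, Y, h1, h2⟩
    exact ⟨X, Y, fun i => (h1 i).elim fun b h => h.elim fun a h => ⟨a, b, h⟩, h2⟩
  · rintro ⟨X, Y, h1, h2⟩
    exact ⟨X, Y, fun i => (h1 i).elim fun b h => h.elim fun a h => ⟨a, b, h⟩, h2⟩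

/-! ### Isomorphisms of DAGs -/

variable {H} {K L : LDAG T}

/-- The inverse of an isomorphism. -/
def Iso.symm (f : H.Iso K) : K.Iso H where
  vEquiv := f.vEquiv.symm
  eEquiv := f.eEquiv.symm
  src_eq e := by rw [Equiv.eq_symm_apply, ← f.src_eq, Equiv.apply_symm_apply]
  tgt_eq e := by rw [Equiv.eq_symm_apply, ← f.tgt_eq, Equiv.apply_symm_apply]
  label_eq v := by rw [← f.label_eq, Equiv.apply_symm_apply]

/-- The composition of isomorphisms. -/
def Iso.trans (f : H.Iso K) (g : K.Iso L) : H.Iso L where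
  vEquiv := f.vEquiv.trans g.vEquiv
  eEquiv := f.eEquiv.trans g.eEquiv
  src_eq e := by simp [g.src_eq, f.src_eq]
  tgt_eq e := by simp [g.tgt_eq, f.tgt_eq]
  label_eq v := by simp [g.label_eq, f.label_eq]

/-- Quantifiers are reindexed along the bijections of vertices, of edges and of their subsets. -/
theorem Iso.sat_iff (f : H.Iso K) {n m p q : ℕ} (φ : MSO₂ T n m p q) (xs : Fin n → H.V)
    (ys : Fin m → H.E) (Xs : Fin p → Set H.V) (Ys : Fin q → Set H.E) :
    φ.Sat H xs ys Xs Ys ↔ φ.Sat K (f.vEquiv ∘ xs) (f.eEquiv ∘ ys) (fun i => f.vEquiv '' Xs i)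
      (fun i => f.eEquiv '' Ys i) := by
  induction φ with
  | memV x X => simp [MSO₂.Sat]
  | memE y Y => simp [MSO₂.Sat]
  | src y x => simp [MSO₂.Sat, f.src_eq]
  | tgt y x => simp [MSO₂.Sat, f.tgt_eq]
  | lab x a => simp [MSO₂.Sat, f.label_eq]
  | and φ ψ ih₁ ih₂ => simp [MSO₂.Sat, ih₁, ih₂]
  | or φ ψ ih₁ ih₂ => simp [MSO₂.Sat, ih₁, ih₂]
  | not φ ih => simp [MSO₂.Sat, ih]
  | exV φ ih =>
    simp only [MSO₂.Sat, ih]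
    rw [← f.vEquiv.exists_congr_right]
    refine exists_congr fun v => iff_of_eq ?_
    congr 1
    funext i
    cases i using Fin.cases <;> rfl
  | exE φ ih =>
    simp only [MSO₂.Sat, ih]
    rw [← f.eEquiv.exists_congr_right]
    refine exists_congr fun v => iff_of_eq ?_
    congr 1
    funext i
    cases i using Fin.cases <;> rfl
  | exVS φ ih =>
    simp only [MSO₂.Sat, ih]
    rw [← (Equiv.Set.congr f.vEquiv).exists_congr_right]
    refine exists_congr fun A => iff_of_eq ?_
    congr 1
    funext i
    cases i using Fin.cases <;> rfl
  | exES φ ih =>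
    simp only [MSO₂.Sat, ih]
    rw [← (Equiv.Set.congr f.eEquiv).exists_congr_right]
    refine exists_congr fun A => iff_of_eq ?_
    congr 1
    funext i
    cases i using Fin.cases <;> rfl

theorem Iso.models_iff (f : H.Iso K) (φ : MSO₂Sentence T) : H.Models φ ↔ K.Models φ := by
  rw [LDAG.Models, f.sat_iff, LDAG.Models]
  apply iff_of_eq
  congr 1 <;> exact Subsingleton.elim _ _

end LDAG

/-! ### Hasse diagrams -/

namespace LPO

variable {T : Type u} (ℓ : LPO T)

theorem lt_of_transGen_hasse_adj {u v : ℓ.V} (h : TransGen ℓ.hasse.Adj u v) : ℓ.lt u v := by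
  have := ℓ.strict
  induction h with
  | single h => obtain ⟨e, rfl, rfl⟩ := h; exact e.2.1
  | tail _ h ih => obtain ⟨e, rfl, rfl⟩ := h; exact trans_of ℓ.lt ih e.2.1

theorem wellFounded_lt : WellFounded ℓ.lt := by
  have := ℓ.finV
  have := ℓ.strict
  exact Finite.wellFounded_of_trans_of_irrefl _

/-- A maximal element `w` of the half-open interval from `u` to `v` is covered by `v`; induction
then connects `u` to `w`. -/
theorem transGen_hasse_adj_iff {u v : ℓ.V} : TransGen ℓ.hasse.Adj u v ↔ ℓ.lt u v := by
  have := ℓ.finV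
  have := ℓ.strict
  refine ⟨ℓ.lt_of_transGen_hasse_adj, ?_⟩
  induction v using ℓ.wellFounded_lt.induction generalizing u with
  | h v ih =>
    intro h
    have wf : WellFounded (Function.swap ℓ.lt) := by
      have : Std.Irrefl (Function.swap ℓ.lt) := ⟨fun a => irrefl_of ℓ.lt a⟩
      have : IsTrans _ (Function.swap ℓ.lt) := ⟨fun _ _ _ h h' => trans_of ℓ.lt h' h⟩
      exact Finite.wellFounded_of_trans_of_irrefl _
    obtain ⟨w, ⟨hw1, hw2⟩, hmax⟩ := wf.has_min {w | ℓ.lt w v ∧ (w = u ∨ ℓ.lt u w)}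
      ⟨u, h, .inl rfl⟩
    have hc : ℓ.Covers w v := by
      refine ⟨hw1, ?_⟩
      rintro ⟨x, hx1, hx2⟩
      refine hmax x ⟨hx2, .inr ?_⟩ hx1
      rcases hw2 with rfl | hw2
      exacts [hx1, _root_.trans hw2 hx1]
    have step : ℓ.hasse.Adj w v := ⟨⟨(w, v), hc⟩, rfl, rfl⟩
    rcases hw2 with rfl | hw2
    · exact .single step
    · exact (ih w hw1 hw2).tail step

/-- The order and its Hasse diagram share vertices and labels, so only the order atom needs an
argument. -/
theorem sat_iff_hasse_sat {n p : ℕ} (φ : MSO T n p) (xs : Fin n → ℓ.V) (Xs : Fin p → Set ℓ.V) :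
    φ.Sat ℓ xs Xs ↔ φ.gr.Sat ℓ.hasse xs ![] Xs ![] := by
  induction φ with
  | mem x X => rfl
  | lt x y =>
    exact ℓ.transGen_hasse_adj_iff.symm.trans (ℓ.hasse.sat_gr_lt xs Xs x y).symm
  | lab x a => rfl
  | and φ ψ ih₁ ih₂ => simp [MSO.Sat, MSO₂.Sat, MSO.gr, ih₁, ih₂]
  | or φ ψ ih₁ ih₂ => simp [MSO.Sat, MSO₂.Sat, MSO.gr, ih₁, ih₂]
  | not φ ih => simp [MSO.Sat, MSO₂.Sat, MSO.gr, ih]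
  | exV φ ih => simp only [MSO.Sat, MSO₂.Sat, MSO.gr, ih]; rfl
  | exVS φ ih => simp only [MSO.Sat, MSO₂.Sat, MSO.gr, ih]; rfl

theorem models_iff_hasse_models (φ : MSOSentence T) : ℓ.Models φ ↔ ℓ.hasse.Models φ.gr :=
  ℓ.sat_iff_hasse_sat φ _ _

/-- The first step of a bypass leads either to a vertex strictly between the ends of a covering
pair, or straight to the target; in the second case it is the same edge, as Hasse diagrams have no
parallel edges. -/
theorem hasse_isTransReduced : ℓ.hasse.IsTransReduced := by
  have := ℓ.strict
  rw [LDAG.isTransReduced_iff]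
  intro e h
  have hne := ℓ.hasse.ne_of_transGen (.single (ℓ.hasse.adj_edge e))
  rcases ReflTransGen.cases_head h with h | ⟨w, ⟨e', he', h1, h2⟩, h'⟩
  · exact hne h
  · have huw : ℓ.lt (ℓ.hasse.src e) w := by rw [← h1, ← h2]; exact e'.2.1
    rcases reflTransGen_iff_eq_or_transGen.1 h' with h' | h'
    · refine he' (Subtype.ext (Prod.ext h1 (h2.trans h'.symm)))
    · exact e.2.2 ⟨w, huw, ℓ.lt_of_transGen_hasse_adj (ℓ.hasse.transGen_adjOn_le _ h')⟩

theorem hasse_tc_isIso : ℓ.hasse.tc.IsIso ℓ :=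
  ⟨⟨Equiv.refl _, ℓ.transGen_hasse_adj_iff.symm⟩, fun _ => rfl⟩

variable {ℓ} {ℓ' : LPO T}

theorem covers_iff_of_relIso (f : ℓ.lt ≃r ℓ'.lt) (u v : ℓ.V) :
    ℓ'.Covers (f u) (f v) ↔ ℓ.Covers u v := by
  simp only [Covers, f.map_rel_iff, f.surjective.exists]

theorem IsIso.hasse_iso (h : ℓ.IsIso ℓ') : Nonempty (ℓ.hasse.Iso ℓ'.hasse) := by
  obtain ⟨f, hf⟩ := h
  exact ⟨{
    vEquiv := f.toEquiv
    eEquiv := (f.toEquiv.prodCongr f.toEquiv).subtypeEquiv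
      fun p => (covers_iff_of_relIso f p.1 p.2).symm
    src_eq := fun _ => rfl
    tgt_eq := fun _ => rfl
    label_eq := hf }⟩

end LPO

namespace LDAG

variable {T : Type u} {H K : LDAG T}

theorem Iso.tc_isIso (f : H.Iso K) : H.tc.IsIso K.tc := by
  have adj : ∀ {H K : LDAG T} (f : H.Iso K) {a b}, H.Adj a b →
      K.Adj (f.vEquiv a) (f.vEquiv b) := by
    rintro H K f _ _ ⟨e, rfl, rfl⟩
    exact ⟨f.eEquiv e, f.src_eq e, f.tgt_eq e⟩
  refine ⟨⟨f.vEquiv, ?_⟩, f.label_eq⟩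
  intro (a : H.V) (b : H.V)
  change TransGen K.Adj (f.vEquiv a) (f.vEquiv b) ↔ TransGen H.Adj a b
  constructor
  · intro h
    have := TransGen.lift (p := H.Adj) f.symm.vEquiv (fun _ _ h => adj f.symm h) _ _ h
    simpa [Iso.symm, Function.onFun] using this
  · exact fun h => TransGen.lift (p := K.Adj) f.vEquiv (fun _ _ h => adj f h) _ _ h

/-- Edges and covering pairs correspond bijectively. A vertex strictly between the ends of an edge
would yield a bypass, and a parallel edge is a bypass. The last edge of a walk joining a covering
pair must start at the lower element. -/
theorem IsTransReduced.iso_hasse_tc (h : H.IsTransReduced) : Nonempty (H.Iso H.tc.hasse) := by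
  rw [isTransReduced_iff] at h
  -- A walk can use `e` only if its start reaches the source of `e` and the target of `e` reaches
  -- its end.
  have avoid : ∀ (e : H.E) {a b}, TransGen H.Adj a b → (a ≠ H.src e ∧
      ¬ TransGen H.Adj a (H.src e) ∨ (b ≠ H.tgt e ∧ ¬ TransGen H.Adj (H.tgt e) b)) →
      TransGen (H.AdjOn {e}ᶜ) a b := by
    intro e a b hab hor
    have key : ∀ {x y}, H.Adj x y → (a = x ∨ TransGen H.Adj a x) →
        (y = b ∨ TransGen H.Adj y b) → H.AdjOn {e}ᶜ x y := by
      rintro x y ⟨e', rfl, rfl⟩ h1 h2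
      refine ⟨e', ?_, rfl, rfl⟩
      rintro rfl
      rcases hor with ⟨h3, h4⟩ | ⟨h3, h4⟩
      · exact h1.elim h3 h4
      · exact h2.elim (fun h => h3 h.symm) h4
    have main : ∀ {y}, TransGen H.Adj a y → (y = b ∨ TransGen H.Adj y b) →
        TransGen (H.AdjOn {e}ᶜ) a y := by
      intro y hy
      induction hy with
      | single h => exact fun hb => .single (key h (.inl rfl) hb)
      | tail h1 h2 ih =>
        intro hb
        refine (ih (.inr ?_)).tail (key h2 (.inr h1) hb)
        rcases hb with rfl | hb
        exacts [.single h2, .head h2 hb]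
    exact main hab (.inl rfl)
  have hcov : ∀ e : H.E, H.tc.Covers (H.src e) (H.tgt e) := by
    refine fun e => ⟨.single (H.adj_edge e), ?_⟩
    rintro ⟨w, h1, h2⟩
    -- The half before `w` avoids `e` because the target of `e` cannot reach `w`, the half after it
    -- because `w` cannot reach the source.
    refine h e (((avoid e h1 (.inr ⟨?_, ?_⟩)).trans
      (avoid e h2 (.inl ⟨?_, ?_⟩))).to_reflTransGen)
    · exact H.ne_of_transGen h2
    · exact fun h3 => H.acyclic _ (h3.trans h2)
    · exact (H.ne_of_transGen h1).symm
    · exact fun h3 => H.acyclic _ (h3.trans h1)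
  refine ⟨⟨Equiv.refl _, Equiv.ofBijective
    (fun e => ⟨(H.src e, H.tgt e), hcov e⟩) ⟨?_, ?_⟩, fun _ => rfl, fun _ => rfl, fun _ => rfl⟩⟩
  · intro e e' he
    obtain ⟨h1, h2⟩ := Prod.ext_iff.1 (Subtype.ext_iff.1 he)
    by_contra hne
    exact h e (.single ⟨e', fun h => hne h.symm, h1.symm, h2.symm⟩)
  · rintro ⟨⟨u, v⟩, huv, hno⟩
    obtain ⟨w, h1, ⟨e, rfl, rfl⟩⟩ := TransGen.tail'_iff.1 huv
    rcases reflTransGen_iff_eq_or_transGen.1 h1 with h1 | h1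
    · exact ⟨e, Subtype.ext (Prod.ext h1 rfl)⟩
    · exact (hno ⟨_, h1, .single (H.adj_edge e)⟩).elim

end LDAG

/-! ### Layouts: explicit descriptions of composed slices -/

section Layout

variable {T : Type u}

/-- The position of the center vertex at which the edge through the in-frontier vertex `i` of the
first slice ends. -/
def trace : List (UnitSlice T) → ℕ → ℕ
  | [], _ => 0
  | S :: U, i => if h : i < S.inn then
      match S.pass ⟨i, h⟩ with
      | some j => trace U j + 1
      | none => 0
    else 0

/-- An edge starts at the center of `S` and ends at the out-frontier vertex `j`. -/
def UnitSlice.Starts (S : UnitSlice T) (j : ℕ) : Prop :=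
  ∃ h : j < S.out, S.pass.symm ⟨j, h⟩ = none

/-- The pair `(k, j)` codes the edge starting at the center of the `k`-th slice and crossing
the `j`-th out-frontier vertex of this slice. -/
def IsEdgeCode (U : List (UnitSlice T)) (p : ℕ × ℕ) : Prop :=
  ∃ S, U[p.1]? = some S ∧ S.Starts p.2

/-- The position of the target of the edge with code `p`. -/
def edgeTarget (U : List (UnitSlice T)) (p : ℕ × ℕ) : ℕ :=
  p.1 + 1 + trace (U.drop (p.1 + 1)) p.2

/-- An identification of the DAG `H` with the DAG described by the unit slices in `U`. -/
structure Layout (H : LDAG T) (U : List (UnitSlice T)) where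
  pos : H.V ≃ Fin U.length
  code : H.E → ℕ × ℕ
  code_injective : Function.Injective code
  mem_range_code : ∀ p, p ∈ Set.range code ↔ IsEdgeCode U p
  label_pos : ∀ v, U[pos v].label = H.label v
  pos_src : ∀ e, (pos (H.src e) : ℕ) = (code e).1
  pos_tgt : ∀ e, (pos (H.tgt e) : ℕ) = edgeTarget U (code e)

/-- DAGs with the same layout are isomorphic. -/
theorem Layout.nonempty_iso {H K : LDAG T} {U : List (UnitSlice T)} (f : Layout H U)
    (g : Layout K U) : Nonempty (H.Iso K) := by
  -- Vertices are matched by position and edges by code: both codings are injective with the same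
  -- range.
  have h : ∀ e, ∃ e', g.code e' = f.code e := fun e =>
    (g.mem_range_code _).2 ((f.mem_range_code _).1 ⟨e, rfl⟩)
  choose F hF using h
  have hF' : Function.Bijective F := by
    refine ⟨fun e e' he => f.code_injective (by rw [← hF, he, hF]), fun e => ?_⟩
    obtain ⟨e', he'⟩ := (f.mem_range_code _).2 ((g.mem_range_code _).1 ⟨e, rfl⟩)
    exact ⟨e', g.code_injective ((hF e').trans he')⟩
  refine ⟨⟨f.pos.trans g.pos.symm, Equiv.ofBijective F hF', fun e => ?_, fun e => ?_,
    fun v => ?_⟩⟩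
  · rw [Equiv.trans_apply, Equiv.eq_symm_apply]
    apply Fin.ext
    rw [g.pos_src, f.pos_src]
    simp [hF]
  · rw [Equiv.trans_apply, Equiv.eq_symm_apply]
    apply Fin.ext
    rw [g.pos_tgt, f.pos_tgt]
    simp [hF]
  · rw [← g.label_pos, ← f.label_pos]
    simp

/-! ### Recursion along the sequence of slices -/

theorem trace_cons_of_pass_eq_some {S : UnitSlice T} (U : List (UnitSlice T)) {i : Fin S.inn}
    {j : Fin S.out} (h : S.pass i = some j) : trace (S :: U) i = trace U j + 1 := by
  simp [trace, h]

theorem trace_cons_of_pass_eq_none {S : UnitSlice T} (U : List (UnitSlice T)) {i : Fin S.inn}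
    (h : S.pass i = none) : trace (S :: U) i = 0 := by
  simp [trace, h]

theorem edgeTarget_cons_zero (S : UnitSlice T) (U : List (UnitSlice T)) (j : ℕ) :
    edgeTarget (S :: U) (0, j) = trace U j + 1 := by
  simp [edgeTarget, add_comm]

theorem edgeTarget_cons_succ (S : UnitSlice T) (U : List (UnitSlice T)) (k j : ℕ) :
    edgeTarget (S :: U) (k + 1, j) = edgeTarget U (k, j) + 1 := by
  simp [edgeTarget]
  omega

theorem isEdgeCode_cons_zero (S : UnitSlice T) (U : List (UnitSlice T)) (j : ℕ) :
    IsEdgeCode (S :: U) (0, j) ↔ S.Starts j := by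
  simp [IsEdgeCode]

theorem isEdgeCode_cons_succ (S : UnitSlice T) (U : List (UnitSlice T)) (k j : ℕ) :
    IsEdgeCode (S :: U) (k + 1, j) ↔ IsEdgeCode U (k, j) := by
  simp [IsEdgeCode]

/-- An identification of the slice `A` with the slice described by the unit slices in `U`, which
may begin with a slice with nonempty in-frontier. An edge is coded by the in-frontier vertex or
by the position and the out-frontier vertex where it starts. -/
structure SliceLayout (A : Slice T) (U : List (UnitSlice T)) where
  out_eq : A.out = 0
  pos : A.C ≃ Fin U.length
  code : A.E → ℕ ⊕ (ℕ × ℕ)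
  code_injective : Function.Injective code
  inl_mem_range : ∀ i, Sum.inl i ∈ Set.range code ↔ i < A.inn
  inr_mem_range : ∀ p, Sum.inr p ∈ Set.range code ↔ IsEdgeCode U p
  label_pos : ∀ v, U[pos v].label = A.label v
  code_eq_of_src_inl : ∀ e i, A.src e = .inl i → code e = .inl i
  code_eq_of_src_inr : ∀ e v, A.src e = .inr v → ∃ j, code e = .inr (pos v, j)
  tgt_eq : ∀ e, ∃ v, A.tgt e = .inl v ∧ (pos v : ℕ) = (code e).elim (trace U) (edgeTarget U)

/-- With both frontiers empty every edge joins two centers, so `toLDAG` discards none. -/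
theorem SliceLayout.nonempty_layout {A : Slice T} {U : List (UnitSlice T)} (f : SliceLayout A U)
    (h : A.inn = 0) : Nonempty (Layout A.toLDAG U) := by
  have hsrc : ∀ e, ∃ v, A.src e = .inr v := by
    intro e
    rcases hs : A.src e with i | v
    · exact (h ▸ i).elim0
    · exact ⟨v, rfl⟩
  have hcode : ∀ p : A.toLDAG.E, ∃ j, f.code p.1.1 = .inr (f.pos p.1.2.1, j) := fun p =>
    f.code_eq_of_src_inr _ _ p.2.1
  choose J hJ using hcode
  have htgt : ∀ p : A.toLDAG.E, (f.pos p.1.2.2 : ℕ) =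
      (f.code p.1.1).elim (trace U) (edgeTarget U) := by
    intro p
    obtain ⟨v, hv, hp⟩ := f.tgt_eq p.1.1
    rw [p.2.2, Sum.inl.injEq] at hv
    rw [hv, hp]
  refine ⟨⟨f.pos, fun p => (f.pos p.1.2.1, J p), ?_, ?_, f.label_pos, fun _ => rfl, ?_⟩⟩
  · intro p p' hp
    have h1 : p.1.1 = p'.1.1 := f.code_injective (by rw [hJ, hJ]; exact congrArg _ hp)
    have h2 := p.2
    rw [h1, p'.2.1, p'.2.2, Sum.inr.injEq, Sum.inl.injEq] at h2
    exact Subtype.ext (Prod.ext h1 (Prod.ext h2.1.symm h2.2.symm))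
  · intro x
    rw [← f.inr_mem_range]
    constructor
    · rintro ⟨p, rfl⟩
      exact ⟨p.1.1, hJ p⟩
    · rintro ⟨e, he⟩
      obtain ⟨v, hv⟩ := hsrc e
      obtain ⟨w, hw, -⟩ := f.tgt_eq e
      refine ⟨⟨(e, v, w), hv, hw⟩, ?_⟩
      have := hJ ⟨(e, v, w), hv, hw⟩
      exact Sum.inr_injective (this.symm.trans he)
  · intro p
    exact (htgt p).trans (by rw [hJ]; rfl)

/-- Codes of the edges of a glued slice. -/
def glueCode (S : UnitSlice T) {A : Slice T} (code : A.E → ℕ ⊕ (ℕ × ℕ))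
    (h : S.out = A.inn) : (S.toSlice.glue A h).E → ℕ ⊕ (ℕ × ℕ)
  | .inl ⟨.inl i, _⟩ => .inl i
  | .inl ⟨.inr j, _⟩ => .inr (0, j.1)
  | .inr (.inl ⟨(.inl i, _), _⟩) => .inl i
  | .inr (.inl ⟨(.inr j, _), _⟩) => .inr (0, j.1)
  | .inr (.inr e') => (code e'.1).map id fun p => (p.1 + 1, p.2)

theorem UnitSlice.tgt_inl_of_none {S : UnitSlice T} {i : Fin S.inn} (h : S.pass i = none) :
    S.toSlice.tgt (.inl i) = .inl () := by
  simp [UnitSlice.toSlice, h]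

theorem UnitSlice.tgt_inl_of_some {S : UnitSlice T} {i : Fin S.inn} {j : Fin S.out}
    (h : S.pass i = some j) : S.toSlice.tgt (.inl i) = .inr j := by
  simp [UnitSlice.toSlice, h]

/-- The positions of the center vertices after gluing a unit slice in front. -/
def glueEquiv {C : Type} {n : ℕ} (f : C ≃ Fin n) : Unit ⊕ C ≃ Fin (n + 1) where
  toFun := Sum.elim (fun _ => 0) fun v => (f v).succ
  invFun := Fin.cases (.inl ()) fun i => .inr (f.symm i)
  left_inv := by rintro (_ | v) <;> simp
  right_inv := by
    intro i
    cases i using Fin.cases <;> simp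

theorem SliceLayout.exists_code_inl {A : Slice T} {U : List (UnitSlice T)} (f : SliceLayout A U)
    {i : ℕ} (h : i < A.inn) : ∃ e, A.src e = .inl ⟨i, h⟩ ∧ f.code e = .inl i := by
  obtain ⟨e, he, -⟩ := A.in_unique ⟨i, h⟩
  exact ⟨e, he, f.code_eq_of_src_inl _ _ he⟩

theorem SliceLayout.src_of_code_inr {A : Slice T} {U : List (UnitSlice T)} (f : SliceLayout A U)
    {e : A.E} {p : ℕ × ℕ} (h : f.code e = .inr p) : (A.src e).isRight := by
  rcases hs : A.src e with i | v
  · rw [f.code_eq_of_src_inl e i hs] at h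
    cases h
  · rfl

/-- Codes only see where an edge starts. A fused pair is determined by its first member, since each
in-frontier vertex of `A` carries one edge; an edge of `S` cannot be both fused and unfused; and
edges starting at centers of `A` have their position shifted away from `0`. -/
theorem glueCode_injective {A : Slice T} {U : List (UnitSlice T)} (f : SliceLayout A U)
    (S : UnitSlice T) (h : S.out = A.inn) : Function.Injective (glueCode S f.code h) := by
  have hr : ∀ e : {e : A.E // (A.src e).isRight}, ∃ p, f.code e.1 = .inr p := by
    rintro ⟨e, he⟩
    rcases hs : A.src e with i | v
    · simp [hs] at he
    · exact (f.code_eq_of_src_inr e v hs).elim fun j hj => ⟨_, hj⟩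
  have hfuse : ∀ (s : S.toSlice.E) (e e' : A.E), Slice.Fused S.toSlice A h s e →
      Slice.Fused S.toSlice A h s e' → e = e' := by
    rintro s e e' ⟨i, h1, h2⟩ ⟨j, h3, h4⟩
    rw [h1, Sum.inr.injEq] at h3
    subst h3
    exact (A.in_unique _).unique h2 h4
  have hleft : ∀ (s : S.toSlice.E) (e : A.E), Slice.Fused S.toSlice A h s e →
      ¬ (S.toSlice.tgt s).isLeft := by
    rintro s e ⟨i, h1, -⟩
    simp [h1]
  rintro (⟨i | j, hi⟩ | ⟨⟨i | j, e⟩, hi⟩ | e) (⟨i' | j', hi'⟩ | ⟨⟨i' | j', e'⟩, hi'⟩ | e') hee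
  all_goals simp only [glueCode, Sum.inl.injEq, Sum.inr.injEq, reduceCtorEq, Prod.mk.injEq,
    true_and] at hee
  · obtain rfl := Fin.ext hee; rfl
  · obtain rfl := Fin.ext hee; exact (hleft _ _ hi' hi).elim
  · obtain ⟨p, hp⟩ := hr e'; simp [hp] at hee
  -- An edge starting at the center of a unit slice always ends in the out-frontier, so it is never
  -- unfused.
  · exact (Bool.noConfusion hi)
  · exact (Bool.noConfusion hi)
  · exact (Bool.noConfusion hi)
  · obtain rfl := Fin.ext hee; exact (hleft _ _ hi hi').elim
  · obtain rfl := Fin.ext hee; obtain rfl := hfuse _ _ _ hi hi'; rfl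
  · obtain ⟨p, hp⟩ := hr e'; simp [hp] at hee
  · exact (Bool.noConfusion hi')
  · obtain rfl := Subtype.ext (Fin.ext hee); obtain rfl := hfuse _ _ _ hi hi'; rfl
  · obtain ⟨p, hp⟩ := hr e'; simp [hp] at hee
  · obtain ⟨p, hp⟩ := hr e; simp [hp] at hee
  · exact (Bool.noConfusion hi')
  · obtain ⟨p, hp⟩ := hr e; simp [hp] at hee
  · obtain ⟨p, hp⟩ := hr e; simp [hp] at hee
  · obtain ⟨p, hp⟩ := hr e
    obtain ⟨p', hp'⟩ := hr e'
    simp only [hp, hp', Sum.map_inr, Sum.inr.injEq, Prod.mk.injEq, add_left_inj] at hee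
    have : e = e' := Subtype.ext (f.code_injective (by rw [hp, hp', Prod.ext hee.1 hee.2]))
    rw [this]

theorem exists_glueCode_eq_inl {A : Slice T} {U : List (UnitSlice T)} (f : SliceLayout A U)
    (S : UnitSlice T) (h : S.out = A.inn) (i : Fin S.inn) :
    ∃ e, glueCode S f.code h e = .inl i := by
  rcases hp : S.pass i with - | j
  · exact ⟨.inl ⟨.inl i, by rw [UnitSlice.tgt_inl_of_none hp]; rfl⟩, rfl⟩
  · obtain ⟨e, he, -⟩ := f.exists_code_inl (i := j) (h ▸ j.2)
    exact ⟨.inr (.inl ⟨(.inl i, e), j, UnitSlice.tgt_inl_of_some hp, he⟩), rfl⟩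

theorem exists_glueCode_eq_inr_zero {A : Slice T} {U : List (UnitSlice T)} (f : SliceLayout A U)
    (S : UnitSlice T) (h : S.out = A.inn) (j : ℕ) (hj : S.Starts j) :
    ∃ e, glueCode S f.code h e = .inr (0, j) := by
  obtain ⟨hj, hn⟩ := hj
  obtain ⟨e, he, -⟩ := f.exists_code_inl (i := j) (h ▸ hj)
  exact ⟨.inr (.inl ⟨(.inr ⟨⟨j, hj⟩, hn⟩, e), ⟨j, hj⟩, rfl, he⟩), rfl⟩

theorem exists_glueCode_eq_inr_succ {A : Slice T} {U : List (UnitSlice T)} (f : SliceLayout A U)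
    (S : UnitSlice T) (h : S.out = A.inn) (k j : ℕ) (hj : IsEdgeCode U (k, j)) :
    ∃ e, glueCode S f.code h e = .inr (k + 1, j) := by
  obtain ⟨e, he⟩ := (f.inr_mem_range _).2 hj
  exact ⟨.inr (.inr ⟨e, f.src_of_code_inr he⟩), by simp [glueCode, he]⟩

/-- Gluing a unit slice in front shifts all positions by one, which is how `trace`, `edgeTarget` and
`IsEdgeCode` recurse on a cons. -/
theorem SliceLayout.nonempty_glue {A : Slice T} {U : List (UnitSlice T)} (f : SliceLayout A U)
    (S : UnitSlice T) (h : S.out = A.inn) :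
    Nonempty (SliceLayout (S.toSlice.glue A h) (S :: U)) := by
  refine ⟨⟨f.out_eq, glueEquiv f.pos, glueCode S f.code h, glueCode_injective f S h, ?_, ?_, ?_, ?_,
    ?_, ?_⟩⟩
  · intro i
    constructor
    · rintro ⟨⟨i' | j', hi'⟩ | ⟨⟨i' | j', e'⟩, hi'⟩ | e', he⟩ <;>
        simp only [glueCode, Sum.inl.injEq, reduceCtorEq] at he
      · exact he ▸ i'.2
      · exact he ▸ i'.2
      · rcases hs : A.src e'.1 with a | v
        · have := e'.2
          simp [hs] at this
        · obtain ⟨j, hj⟩ := f.code_eq_of_src_inr _ _ hs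
          simp [hj] at he
    · intro hi
      exact exists_glueCode_eq_inl f S h ⟨i, hi⟩
  · rintro ⟨k, j⟩
    constructor
    · rintro ⟨⟨i' | j', hi'⟩ | ⟨⟨i' | j', e'⟩, hi'⟩ | e', he⟩ <;>
        simp only [glueCode, Sum.inr.injEq, reduceCtorEq, Prod.mk.injEq] at he
      · exact Bool.noConfusion hi'
      · obtain ⟨rfl, rfl⟩ := he
        exact (isEdgeCode_cons_zero S U _).2 ⟨j'.1.2, j'.2⟩
      · rcases hc : f.code e'.1 with a | p
        · simp [hc] at he
        · simp only [hc, Sum.map_inr, Sum.inr.injEq, Prod.mk.injEq] at he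
          obtain ⟨rfl, rfl⟩ := he
          exact (isEdgeCode_cons_succ S U _ _).2 ((f.inr_mem_range _).1 ⟨_, hc⟩)
    · intro hp
      rcases k with - | k
      · exact exists_glueCode_eq_inr_zero f S h j ((isEdgeCode_cons_zero S U j).1 hp)
      · exact exists_glueCode_eq_inr_succ f S h k j ((isEdgeCode_cons_succ S U k j).1 hp)
  · rintro (v | v)
    · rfl
    · exact f.label_pos v
  · rintro (⟨i' | j', hi'⟩ | ⟨⟨i' | j', e'⟩, hi'⟩ | e') i he
    · cases he; rfl
    · cases he
    · cases he; rfl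
    · cases he
    · cases he
  · rintro (⟨i' | j', hi'⟩ | ⟨⟨i' | j', e'⟩, hi'⟩ | e') v he
    · cases he
    · exact Bool.noConfusion hi'
    · cases he
    · cases he
      exact ⟨j', rfl⟩
    · cases he
      obtain ⟨j, hj⟩ := f.code_eq_of_src_inr e'.1 _ (Sum.inr_getRight _ e'.2).symm
      exact ⟨j, by simp only [glueCode, hj]; rfl⟩
  -- A fused edge ends where its second member ends, and that place is traced from the frontier
  -- vertex `j` at which the two meet.
  · have key : ∀ (j : Fin S.out) (e : A.E), A.src e = .inl (j.cast h) →
        ∃ v, A.tgt e = .inl v ∧ (f.pos v : ℕ) = trace U j := by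
      intro j e hs
      obtain ⟨v, hv, hp⟩ := f.tgt_eq e
      rw [f.code_eq_of_src_inl _ _ hs] at hp
      exact ⟨v, hv, hp⟩
    rintro (⟨i' | j', hi'⟩ | ⟨⟨i' | j', e'⟩, j, hj1, hj2⟩ | e')
    · rcases hp : S.pass i' with - | j
      · exact ⟨.inl (), rfl, (trace_cons_of_pass_eq_none U hp).symm⟩
      · rw [UnitSlice.tgt_inl_of_some hp] at hi'
        exact Bool.noConfusion hi'
    · exact Bool.noConfusion hi'
    · obtain ⟨v, hv, hp⟩ := key j e' hj2
      rcases hp' : S.pass i' with - | j'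
      · dsimp only at hj1
        rw [UnitSlice.tgt_inl_of_none hp'] at hj1
        cases hj1
      · dsimp only at hj1
        rw [UnitSlice.tgt_inl_of_some hp'] at hj1
        obtain rfl : j' = j := Sum.inr_injective hj1
        refine ⟨.inr v, by simp [Slice.glue, hv], ?_⟩
        change (f.pos v : ℕ) + 1 = trace (S :: U) i'
        rw [trace_cons_of_pass_eq_some U hp', hp]
    · obtain ⟨v, hv, hp⟩ := key j e' hj2
      obtain rfl : j'.1 = j := Sum.inr_injective hj1
      refine ⟨.inr v, by simp [Slice.glue, hv], ?_⟩
      change (f.pos v : ℕ) + 1 = edgeTarget (S :: U) (0, j'.1)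
      rw [edgeTarget_cons_zero, hp]
    · obtain ⟨v, hv, hp⟩ := f.tgt_eq e'.1
      obtain ⟨j, hj⟩ := f.code_eq_of_src_inr e'.1 _ (Sum.inr_getRight _ e'.2).symm
      refine ⟨.inr v, by simp [Slice.glue, hv], ?_⟩
      change (f.pos v : ℕ) + 1 = _
      simp only [glueCode, hj, Sum.map_inr, Sum.elim_inr, edgeTarget_cons_succ, hp]

/-- The layout of the empty slice. -/
def SliceLayout.empty : SliceLayout (Slice.empty : Slice T) [] where
  out_eq := rfl
  pos := ⟨Empty.elim, fun i => i.elim0, fun v => v.elim, fun i => i.elim0⟩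
  code := Empty.elim
  code_injective := fun e => e.elim
  inl_mem_range := fun i => ⟨fun ⟨e, _⟩ => e.elim, fun h => absurd h (Nat.not_lt_zero i)⟩
  inr_mem_range := fun p => ⟨fun ⟨e, _⟩ => e.elim, fun ⟨S, h, _⟩ => by simp at h⟩
  label_pos := fun v => v.elim
  code_eq_of_src_inl := fun e => e.elim
  code_eq_of_src_inr := fun e => e.elim
  tgt_eq := fun e => e.elim

/-- No condition on the first in-frontier, so that the induction applies to tails. The second
conclusion is carried along because it makes the test in `composedSlice` succeed. -/
theorem nonempty_sliceLayout_composedSlice (U : List (UnitSlice T))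
    (hc : U.IsChain fun S S' => S.out = S'.inn) (hf : ∀ S ∈ U.getLast?, S.out = 0) :
    Nonempty (SliceLayout (composedSlice U) U) ∧
      ∀ S ∈ U.head?, (composedSlice U).inn = S.inn := by
  induction U with
  | nil => exact ⟨⟨SliceLayout.empty⟩, by simp⟩
  | cons S U ih =>
    obtain ⟨⟨f⟩, hinn⟩ := ih hc.of_cons (by
      intro S' hS'
      apply hf
      cases U with
      | nil => simp at hS'
      | cons => simpa [List.getLast?_cons_cons] using hS')
    have h : S.out = (composedSlice U).inn := by
      cases U with
      | nil => exact hf S (by simp)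
      | cons S' U =>
        rw [hinn S' (by simp)]
        exact (List.isChain_cons_cons.1 hc).1
    have heq : composedSlice (S :: U) = S.toSlice.glue (composedSlice U) h := by
      rw [composedSlice, dif_pos h]
    rw [heq]
    exact ⟨f.nonempty_glue S h, by simp [Slice.glue, UnitSlice.toSlice]⟩

theorem IsUnitDecomposition.nonempty_layout {U : List (UnitSlice T)} (h : IsUnitDecomposition U) :
    Nonempty (Layout (composed U) U) := by
  obtain ⟨⟨f⟩, hinn⟩ := nonempty_sliceLayout_composedSlice U h.chain h.final
  refine f.nonempty_layout ?_
  cases U with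
  | nil => rfl
  | cons S U => rw [hinn S (by simp), h.initial S (by simp)]

end Layout

/-! ### Widths of unit decompositions -/

section Width

variable {T : Type u}

/-- The summand `+ 1` in `edgeTarget` makes the order of the slices a topological ordering. -/
theorem Layout.pos_src_lt_pos_tgt {H : LDAG T} {U : List (UnitSlice T)} (f : Layout H U)
    (e : H.E) : f.pos (H.src e) < f.pos (H.tgt e) := by
  rw [Fin.lt_def, f.pos_src, f.pos_tgt, edgeTarget]
  omega

theorem Layout.pos_lt_pos_of_transGen {H : LDAG T} {U : List (UnitSlice T)} (f : Layout H U)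
    {u v : H.V} (h : TransGen H.Adj u v) : f.pos u < f.pos v := by
  induction h with
  | single h => obtain ⟨e, rfl, rfl⟩ := h; exact f.pos_src_lt_pos_tgt e
  | tail _ h ih => obtain ⟨e, rfl, rfl⟩ := h; exact ih.trans (f.pos_src_lt_pos_tgt e)

/-- A path crosses each cut of a layout at most once. -/
theorem Layout.eq_of_mem_path {H : LDAG T} {U : List (UnitSlice T)} (f : Layout H U) {X : Set H.V}
    {Y : Set H.E} (hY : H.IsPath X Y) {k : ℕ} {e e' : H.E} (he : e ∈ Y) (he' : e' ∈ Y)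
    (h1 : (f.pos (H.src e) : ℕ) < k) (h2 : k ≤ f.pos (H.tgt e))
    (h1' : (f.pos (H.src e') : ℕ) < k) (h2' : k ≤ f.pos (H.tgt e')) : e = e' := by
  obtain ⟨_, _, m, v, ε, -, hε, -, -, -, rfl⟩ := hY
  obtain ⟨a, rfl⟩ := he
  obtain ⟨b, rfl⟩ := he'
  -- An earlier edge of the path ends no later than a later one starts, so the two cannot straddle
  -- the same cut.
  have key : ∀ a b : Fin m, a < b → (f.pos (H.tgt (ε a)) : ℕ) ≤ f.pos (H.src (ε b)) := by
    intro a b hab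
    rw [(hε a).2, (hε b).1]
    rcases (show a.succ ≤ b.castSucc from hab).eq_or_lt with h | h
    · rw [h]
    · exact (f.pos_lt_pos_of_transGen (H.transGen_adjOn_le _
        (H.transGen_of_walk v Set.univ ε (fun _ => trivial) hε h))).le
  rcases lt_trichotomy a b with h | h | h
  · have := key a b h; omega
  · rw [h]
  · have := key b a h; omega

theorem IsUnitDecomposition.out_eq_inn {U : List (UnitSlice T)} (h : IsUnitDecomposition U)
    {k : ℕ} (hk : k + 1 < U.length) : (U[k]'(by omega)).out = U[k + 1].inn :=
  List.isChain_iff_getElem.1 h.chain k hk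

theorem IsUnitDecomposition.inn_zero {U : List (UnitSlice T)} (h : IsUnitDecomposition U)
    (hk : 0 < U.length) : U[0].inn = 0 :=
  h.initial _ (by rw [List.head?_eq_getElem?, List.getElem?_eq_getElem hk]; rfl)

theorem IsUnitDecomposition.out_last {U : List (UnitSlice T)} (h : IsUnitDecomposition U)
    {k : ℕ} (hk : k + 1 = U.length) : (U[k]'(by omega)).out = 0 :=
  h.final _ (by
    have : U.length - 1 = k := by omega
    rw [List.getLast?_eq_getElem?, this, List.getElem?_eq_getElem (by omega)]
    rfl)

/-- The edges passing through the in-frontier of the `k`-th slice. -/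
theorem IsUnitDecomposition.exists_crossing {U : List (UnitSlice T)} (h : IsUnitDecomposition U)
    (k : ℕ) (hk : k < U.length) : ∃ g : Fin U[k].inn → ℕ × ℕ, Function.Injective g ∧
      ∀ i, IsEdgeCode U (g i) ∧ (g i).1 < k ∧ edgeTarget U (g i) = k + trace (U.drop k) i := by
  induction k with
  | zero =>
    have : IsEmpty (Fin U[0].inn) := by rw [h.inn_zero hk]; infer_instance
    exact ⟨fun i => isEmptyElim i, fun i => isEmptyElim i, fun i => isEmptyElim i⟩
  | succ k ih =>
    have hk' : k < U.length := by omega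
    obtain ⟨g, hg, hg'⟩ := ih hk'
    have hout := h.out_eq_inn hk
    have hdrop : U.drop k = U[k] :: U.drop (k + 1) := List.drop_eq_getElem_cons hk'
    -- The edge at a frontier vertex either starts in slice `k`, or passes through it and inherits
    -- its code. Inherited codes have first component below `k`, so the two kinds never collide.
    have hex : ∀ i : Fin U[k + 1].inn, ∃ p : ℕ × ℕ,
        (U[k].pass.symm (i.cast hout.symm) = none ∧ p = (k, (i : ℕ))) ∨
        (∃ i', U[k].pass i' = some (i.cast hout.symm) ∧ p = g i') := by
      intro i
      rcases hp : U[k].pass.symm (i.cast hout.symm) with - | i'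
      · exact ⟨_, .inl ⟨rfl, rfl⟩⟩
      · exact ⟨_, .inr ⟨i', (PEquiv.eq_some_iff _).1 hp, rfl⟩⟩
    choose G hG using hex
    refine ⟨G, ?_, ?_⟩
    · intro i j hij
      rcases hG i with ⟨h1, h2⟩ | ⟨i', h1, h2⟩ <;> rcases hG j with ⟨h3, h4⟩ | ⟨j', h3, h4⟩
      · rw [h2, h4, Prod.mk.injEq] at hij
        exact Fin.ext hij.2
      · have := (hg' j').2.1
        rw [← h4, ← hij, h2] at this
        exact absurd this (lt_irrefl _)
      · have := (hg' i').2.1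
        rw [← h2, hij, h4] at this
        exact absurd this (lt_irrefl _)
      · have : i' = j' := hg (by rw [← h2, ← h4, hij])
        subst this
        rw [h1, Option.some.injEq] at h3
        simpa [Fin.ext_iff] using h3
    · intro i
      rcases hG i with ⟨h1, h2⟩ | ⟨i', h1, h2⟩
      · rw [h2]
        exact ⟨⟨U[k], List.getElem?_eq_getElem hk', (i.cast hout.symm).2, h1⟩, Nat.lt_succ_self k,
          rfl⟩
      · rw [h2]
        obtain ⟨h3, h4, h5⟩ := hg' i'
        refine ⟨h3, by omega, ?_⟩
        rw [h5, hdrop, trace_cons_of_pass_eq_some _ h1]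
        simp only [Fin.val_cast]
        omega

/-- The width of a unit decomposition of a DAG which is a union of `c` paths is at most `c`. -/
theorem IsUnitDecomposition.mem_sliceAlphabet {U : List (UnitSlice T)}
    (h : IsUnitDecomposition U) {c : ℕ} (hc : (composed U).CoverableBy c) (S : UnitSlice T)
    (hS : S ∈ U) : S ∈ sliceAlphabet c T := by
  obtain ⟨f⟩ := h.nonempty_layout
  obtain ⟨X, Y, hXY, -, hE⟩ := hc
  have hinn : ∀ (k : ℕ) (hk : k < U.length), U[k].inn ≤ c := by
    intro k hk
    obtain ⟨g, hg, hg'⟩ := h.exists_crossing k hk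
    have : ∀ i, ∃ e, f.code e = g i := fun i => (f.mem_range_code _).2 (hg' i).1
    choose ε hε using this
    choose r hr using hE
    -- Choosing for each crossing edge a path that contains it is injective, as a path crosses the
    -- cut only once.
    have hinj : Function.Injective fun i => r (ε i) := by
      intro i j hij
      dsimp only at hij
      apply hg
      rw [← hε, ← hε]
      congr 1
      have key : ∀ i, (f.pos ((composed U).src (ε i)) : ℕ) < k ∧
          k ≤ f.pos ((composed U).tgt (ε i)) := by
        intro i
        rw [f.pos_src, f.pos_tgt, hε, (hg' i).2.2]
        exact ⟨(hg' i).2.1, Nat.le_add_right _ _⟩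
      exact f.eq_of_mem_path (hXY (r (ε i))) (hr _) (hij ▸ hr _) (key i).1 (key i).2 (key j).1
        (key j).2
    simpa using Fintype.card_le_of_injective _ hinj
  obtain ⟨k, hk, rfl⟩ := List.getElem_of_mem hS
  refine max_le (hinn k hk) ?_
  rcases Nat.lt_or_ge (k + 1) U.length with h' | h'
  · rw [h.out_eq_inn h']
    exact hinn _ h'
  · rw [h.out_last (by omega)]
    exact Nat.zero_le c

end Width

/-! ### Every DAG has a unit decomposition -/

section Existence

variable {T : Type u}

/-- Every DAG has a topological ordering. -/
theorem LDAG.exists_topological_ordering (H : LDAG T) :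
    ∃ (n : ℕ) (pos : H.V ≃ Fin n), ∀ e, pos (H.src e) < pos (H.tgt e) := by
  classical
  have := H.finV
  have := Fintype.ofFinite H.V
  have : IsPartialOrder H.V (ReflTransGen H.Adj) :=
    { refl := fun _ => .refl
      trans := fun _ _ _ h h' => h.trans h'
      antisymm := by
        intro a b h h'
        rcases reflTransGen_iff_eq_or_transGen.1 h with h | h
        · exact h.symm
        · exact (H.acyclic a (h.trans_left h')).elim }
  -- Szpilrajn extension of reachability, which acyclicity makes a partial order.
  obtain ⟨s, hs, hrs⟩ := extend_partialOrder (ReflTransGen H.Adj)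
  let L : LinearOrder H.V :=
    { le := s
      le_refl := fun a => refl_of s a
      le_trans := fun _ _ _ h h' => trans_of s h h'
      le_antisymm := fun _ _ h h' => antisymm_of s h h'
      le_total := fun a b => total_of s a b
      toDecidableLE := Classical.decRel _ }
  refine ⟨Fintype.card H.V, (Fintype.orderIsoFinOfCardEq H.V rfl).symm.toEquiv, fun e => ?_⟩
  have h1 : H.src e ≤ H.tgt e := hrs _ _ (.single (H.adj_edge e))
  have h2 : H.src e < H.tgt e := lt_of_le_of_ne h1 (H.ne_of_transGen (.single (H.adj_edge e)))
  exact (Fintype.orderIsoFinOfCardEq H.V rfl).symm.lt_iff_lt.2 h2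

variable (H : LDAG T) {n : ℕ} (pos : H.V ≃ Fin n)

/-- The edges crossing the cut before position `k`. -/
abbrev LDAG.Cut (k : ℕ) : Type := {e : H.E // (pos (H.src e) : ℕ) < k ∧ k ≤ pos (H.tgt e)}

instance (k : ℕ) : Finite (H.Cut pos k) := by
  have := H.finE
  infer_instance

/-- A numbering of the edges crossing a cut. -/
noncomputable def LDAG.cutEquiv (k : ℕ) : H.Cut pos k ≃ Fin (Nat.card (H.Cut pos k)) :=
  Finite.equivFin _

/-- The partial bijection between the numberings of two consecutive cuts. -/
noncomputable def LDAG.cutPass (k : ℕ) :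
    Fin (Nat.card (H.Cut pos k)) ≃. Fin (Nat.card (H.Cut pos (k + 1))) where
  toFun := fun i =>
    if h : k + 1 ≤ pos (H.tgt ((H.cutEquiv pos k).symm i).1) then
      some (H.cutEquiv pos (k + 1)
        ⟨((H.cutEquiv pos k).symm i).1, ((H.cutEquiv pos k).symm i).2.1.trans k.lt_succ_self, h⟩)
    else none
  invFun := fun j =>
    if h : (pos (H.src ((H.cutEquiv pos (k + 1)).symm j).1) : ℕ) < k then
      some (H.cutEquiv pos k
        ⟨((H.cutEquiv pos (k + 1)).symm j).1, h,
          k.le_succ.trans ((H.cutEquiv pos (k + 1)).symm j).2.2⟩)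
    else none
  inv := by
    intro i j
    obtain ⟨⟨e, he⟩, rfl⟩ := (H.cutEquiv pos k).surjective i
    obtain ⟨⟨e', he'⟩, rfl⟩ := (H.cutEquiv pos (k + 1)).surjective j
    simp only [Equiv.symm_apply_apply, Option.dite_none_right_eq_some,
      Option.some.injEq, EmbeddingLike.apply_eq_iff_eq]
    constructor
    · rintro ⟨h, h'⟩
      obtain rfl : e' = e := congrArg Subtype.val h'
      exact ⟨he'.2, rfl⟩
    · rintro ⟨h, h'⟩
      obtain rfl : e = e' := congrArg Subtype.val h'
      exact ⟨he.1, rfl⟩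

theorem LDAG.cutPass_of_lt (k : ℕ) (e : H.E) (h1 : (pos (H.src e) : ℕ) < k)
    (h2 : k < pos (H.tgt e)) : H.cutPass pos k (H.cutEquiv pos k ⟨e, h1, h2.le⟩) =
      some (H.cutEquiv pos (k + 1) ⟨e, h1.trans k.lt_succ_self, h2⟩) := by
  change dite _ _ _ = _
  simp only [Equiv.symm_apply_apply]
  exact dif_pos h2

theorem LDAG.cutPass_of_eq (k : ℕ) (e : H.E) (h1 : (pos (H.src e) : ℕ) < k)
    (h2 : k = pos (H.tgt e)) : H.cutPass pos k (H.cutEquiv pos k ⟨e, h1, h2.le⟩) = none := by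
  change dite _ _ _ = _
  simp only [Equiv.symm_apply_apply]
  exact dif_neg (by omega)

/-- An edge of the cut `k + 1` is missing from the cut `k` precisely when it starts in between, at
position `k`. -/
theorem LDAG.cutPass_symm_eq_none_iff (k : ℕ) (e : H.Cut pos (k + 1)) :
    (H.cutPass pos k).symm (H.cutEquiv pos (k + 1) e) = none ↔ (pos (H.src e.1) : ℕ) = k := by
  have h : (H.cutPass pos k).symm (H.cutEquiv pos (k + 1) e) = dite _ _ _ := rfl
  rw [h]
  simp only [Equiv.symm_apply_apply, dite_eq_right_iff, reduceCtorEq, imp_false]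
  have := e.2.1
  omega

/-- The unit slice at a position of a topological ordering. -/
noncomputable def LDAG.unitSlice (k : Fin n) : UnitSlice T where
  inn := Nat.card (H.Cut pos k)
  out := Nat.card (H.Cut pos (k + 1))
  label := H.label (pos.symm k)
  pass := H.cutPass pos k

theorem LDAG.unitSlice_starts_iff (k : Fin n) (j : ℕ) :
    (H.unitSlice pos k).Starts j ↔ ∃ e : H.Cut pos (k + 1), (pos (H.src e.1) : ℕ) = k ∧
      H.cutEquiv pos (k + 1) e = j := by
  constructor
  · rintro ⟨hj, hn⟩
    obtain ⟨e, hje⟩ := (H.cutEquiv pos (k + 1)).surjective ⟨j, hj⟩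
    refine ⟨e, ?_, congrArg Fin.val hje⟩
    rw [← H.cutPass_symm_eq_none_iff, hje]
    exact hn
  · rintro ⟨e, h1, rfl⟩
    exact ⟨(H.cutEquiv pos (k + 1) e).2, (H.cutPass_symm_eq_none_iff pos k e).2 h1⟩

/-- The unit decomposition along a topological ordering. -/
noncomputable def LDAG.unitDecomposition : List (UnitSlice T) := List.ofFn (H.unitSlice pos)

theorem LDAG.length_unitDecomposition : (H.unitDecomposition pos).length = n := by
  simp [unitDecomposition]

/-- Neighbouring slices share the numbering of the cut between them, and no edge crosses the two
outer cuts. -/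
theorem LDAG.isUnitDecomposition : IsUnitDecomposition (H.unitDecomposition pos) where
  chain := by
    rw [List.isChain_iff_getElem]
    intro i hi
    simp [unitDecomposition, unitSlice]
  initial := by
    intro S hS
    rw [unitDecomposition, List.head?_eq_getElem?, Option.mem_def,
      List.getElem?_eq_some_iff] at hS
    obtain ⟨h, rfl⟩ := hS
    simp only [List.getElem_ofFn, unitSlice]
    exact (Nat.card_eq_zero.2 (.inl ⟨fun e => Nat.not_lt_zero _ e.2.1⟩))
  final := by
    intro S hS
    rw [unitDecomposition, List.getLast?_eq_getElem?, Option.mem_def,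
      List.getElem?_eq_some_iff] at hS
    obtain ⟨h, rfl⟩ := hS
    simp only [List.getElem_ofFn, unitSlice]
    refine (Nat.card_eq_zero.2 (.inl ⟨fun e => ?_⟩))
    have h1 := e.2.2
    have h2 := (pos (H.tgt e.1)).2
    simp only [List.length_ofFn] at h1 h
    omega

theorem LDAG.drop_unitDecomposition (k : Fin n) : (H.unitDecomposition pos).drop k =
    H.unitSlice pos k :: (H.unitDecomposition pos).drop (k + 1) := by
  rw [List.drop_eq_getElem_cons (by rw [H.length_unitDecomposition]; exact k.2)]
  simp [unitDecomposition]

theorem LDAG.trace_drop_unitDecomposition (e : H.E) (k d : ℕ) (h1 : (pos (H.src e) : ℕ) < k)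
    (h2 : k + d = pos (H.tgt e)) : trace ((H.unitDecomposition pos).drop k)
      (H.cutEquiv pos k ⟨e, h1, by omega⟩) = d := by
  have hk : k < n := by
    have := (pos (H.tgt e)).2
    omega
  induction d generalizing k with
  | zero =>
    rw [H.drop_unitDecomposition pos ⟨k, hk⟩]
    exact trace_cons_of_pass_eq_none _ (H.cutPass_of_eq pos k e h1 h2)
  | succ d ih =>
    rw [H.drop_unitDecomposition pos ⟨k, hk⟩]
    refine (trace_cons_of_pass_eq_some _ (H.cutPass_of_lt pos k e h1 (by omega))).trans ?_
    have := (pos (H.tgt e)).2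
    rw [ih (k + 1) (by omega) (by omega) (by omega)]

theorem LDAG.isEdgeCode_unitDecomposition_iff (p : ℕ × ℕ) :
    IsEdgeCode (H.unitDecomposition pos) p ↔
      ∃ h : p.1 < n, (H.unitSlice pos ⟨p.1, h⟩).Starts p.2 := by
  simp only [IsEdgeCode, List.getElem?_eq_some_iff, H.length_unitDecomposition]
  constructor
  · rintro ⟨_, ⟨h, rfl⟩, hs⟩
    exact ⟨h, by simpa [unitDecomposition] using hs⟩
  · rintro ⟨h, hs⟩
    exact ⟨_, ⟨h, rfl⟩, by simpa [unitDecomposition] using hs⟩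

theorem LDAG.nonempty_layout_unitDecomposition
    (hpos : ∀ e, pos (H.src e) < pos (H.tgt e)) :
    Nonempty (Layout H (H.unitDecomposition pos)) := by
  refine ⟨⟨pos.trans (finCongr (H.length_unitDecomposition pos).symm),
    fun e => (pos (H.src e), H.cutEquiv pos (pos (H.src e) + 1)
      ⟨e, Nat.lt_succ_self _, hpos e⟩), ?_, ?_, ?_, ?_, ?_⟩⟩
  · intro e e' he
    obtain ⟨h1, h2⟩ := Prod.mk.injEq .. ▸ he
    -- The cut occurs in the type of its numbering; a variable `k` allows equal source positions to
    -- be substituted.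
    have key : ∀ (k : ℕ) (hk : k = pos (H.src e)), ((H.cutEquiv pos (k + 1)
        ⟨e, by omega, by have := hpos e; omega⟩ : Fin _) : ℕ) =
        H.cutEquiv pos (pos (H.src e) + 1) ⟨e, Nat.lt_succ_self _, hpos e⟩ := by
      rintro _ rfl
      rfl
    rw [← key _ h1.symm] at h2
    exact congrArg Subtype.val ((H.cutEquiv pos _).injective (Fin.ext h2))
  · rintro ⟨k, j⟩
    rw [H.isEdgeCode_unitDecomposition_iff]
    simp only [H.unitSlice_starts_iff]
    constructor
    · rintro ⟨e, he⟩
      obtain ⟨rfl, rfl⟩ := Prod.mk.injEq .. ▸ he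
      exact ⟨(pos (H.src e)).2, _, rfl, rfl⟩
    · rintro ⟨hk, ⟨e, he⟩, h1, h2⟩
      dsimp only at h1 h2
      subst h1
      exact ⟨e, Prod.ext rfl h2⟩
  · intro v
    simp only [unitDecomposition, Fin.getElem_fin, List.getElem_ofFn, unitSlice]
    exact congrArg H.label (pos.symm_apply_apply v)
  · intro e
    rfl
  · intro e
    have := hpos e
    change (pos (H.tgt e) : ℕ) = _ + 1 + _
    dsimp only
    rw [H.trace_drop_unitDecomposition pos e _ (pos (H.tgt e) - (pos (H.src e) + 1))
      (Nat.lt_succ_self _) (by omega)]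
    omega

/-- `H` and the composed DAG have layouts over the same sequence of slices, and a layout determines
the DAG. -/
theorem LDAG.exists_isUnitDecomposition :
    ∃ U, IsUnitDecomposition U ∧ Nonempty ((composed U).Iso H) := by
  obtain ⟨n, pos, hpos⟩ := H.exists_topological_ordering
  obtain ⟨f⟩ := H.nonempty_layout_unitDecomposition pos hpos
  obtain ⟨g⟩ := (H.isUnitDecomposition pos).nonempty_layout
  exact ⟨_, H.isUnitDecomposition pos, g.nonempty_iso f⟩

end Existence

/-! ### Regular languages -/

namespace Language

universe v w

variable {α : Type v} {β : Type w}

/-- The language of words satisfying `P`. -/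
def ofPred (P : List α → Prop) : Language α := Set.ofPred P

theorem mem_ofPred {P : List α → Prop} {x : List α} : x ∈ ofPred P ↔ P x := Iff.rfl

/-- A language is regular if it is recognized by a finite automaton reading words from right to
left. -/
theorem isRegular_ofPred_of_foldr {P : List α → Prop} {σ : Type} [Finite σ] (δ : α → σ → σ)
    (s₀ : σ) (acc : σ → Prop) (h : ∀ x, P x ↔ acc (x.foldr δ s₀)) : (ofPred P).IsRegular := by
  have := Fintype.ofFinite σ
  apply IsRegular.of_reverse
  refine ⟨σ, inferInstance, ⟨fun s a => δ a s, s₀, {s | acc s}⟩, ?_⟩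
  ext x
  rw [DFA.mem_accepts, Language.mem_reverse, mem_ofPred, h, List.foldr_reverse]
  rfl

/-- Regularity is invariant under reversal. Right-to-left runs are preferred because they follow the
list recursion of `trace`. -/
theorem IsRegular.exists_foldr {L : Language α} (h : L.IsRegular) : ∃ (σ : Type) (_ : Finite σ)
    (δ : α → σ → σ) (s₀ : σ) (acc : σ → Prop), ∀ x, x ∈ L ↔ acc (x.foldr δ s₀) := by
  obtain ⟨σ, hσ, M, hM⟩ := h.reverse
  refine ⟨σ, inferInstance, fun a s => M.step s a, M.start, (· ∈ M.accept), fun x => ?_⟩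
  rw [← Language.reverse_mem_reverse, ← hM, DFA.mem_accepts]
  simp only [DFA.eval, DFA.evalFrom, List.foldl_reverse]

/-- Images of regular languages under letter-to-letter maps are regular. -/
theorem IsRegular.image_map {L : Language α} (h : L.IsRegular) (f : α → β) :
    (ofPred fun y => ∃ x ∈ L, x.map f = y).IsRegular := by
  obtain ⟨σ, hσ, δ, s₀, acc, hL⟩ := h.exists_foldr
  -- Subset construction: the state is the set of states reached on the preimages of the word read
  -- so far.
  have key : ∀ y : List β, y.foldr (fun b (A : Set σ) => {s | ∃ a, f a = b ∧ ∃ t ∈ A, s = δ a t})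
      {s₀} = {s | ∃ x : List α, x.map f = y ∧ s = x.foldr δ s₀} := by
    intro y
    induction y with
    | nil =>
      ext s
      simp
    | cons b y ih =>
      ext s
      rw [List.foldr_cons, ih]
      constructor
      · rintro ⟨a, rfl, _, ⟨x, rfl, rfl⟩, rfl⟩
        exact ⟨a :: x, rfl, rfl⟩
      · rintro ⟨x, hx, rfl⟩
        obtain ⟨a, x, rfl, rfl, rfl⟩ := List.map_eq_cons_iff.1 hx
        exact ⟨a, rfl, _, ⟨x, rfl, rfl⟩, rfl⟩
  refine isRegular_ofPred_of_foldr
    (fun b (A : Set σ) => {s | ∃ a, f a = b ∧ ∃ t ∈ A, s = δ a t}) {s₀}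
    (fun A => ∃ s ∈ A, acc s) fun y => ?_
  rw [key]
  constructor
  · rintro ⟨x, hx, rfl⟩
    exact ⟨_, ⟨x, rfl, rfl⟩, (hL x).1 hx⟩
  · rintro ⟨_, ⟨x, rfl, rfl⟩, hs⟩
    exact ⟨x, (hL x).2 hs, rfl⟩

/-- `Prop` itself serves as the two-element state set. -/
theorem isRegular_exists_mem (P : α → Prop) : (ofPred fun x => ∃ a ∈ x, P a).IsRegular := by
  refine isRegular_ofPred_of_foldr (fun a (s : Prop) => P a ∨ s) False id fun x => ?_
  induction x with
  | nil => simp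
  | cons a x ih => simpa using or_congr_right ih

theorem isRegular_forall_mem (P : α → Prop) : (ofPred fun x => ∀ a ∈ x, P a).IsRegular := by
  refine isRegular_ofPred_of_foldr (fun a (s : Prop) => P a ∧ s) True id fun x => ?_
  induction x with
  | nil => simp
  | cons a x ih => simpa using and_congr_right fun _ => ih

/-- The words in which at most one letter satisfies `P` form a regular language. -/
theorem isRegular_pairwise_not_and (P : α → Prop) :
    (ofPred fun x => x.Pairwise fun a b => ¬ (P a ∧ P b)).IsRegular := by
  -- The state records whether `P` has occurred, and whether it has occurred at most once.
  have key : ∀ x : List α, x.foldr (fun a (s : Prop × Prop) => (P a ∨ s.1, s.2 ∧ ¬ (P a ∧ s.1)))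
      (False, True) = (∃ a ∈ x, P a, x.Pairwise fun a b => ¬ (P a ∧ P b)) := by
    intro x
    induction x with
    | nil => simp
    | cons a x ih =>
      rw [List.foldr_cons, ih]
      ext
      · simp
      · simp only [List.pairwise_cons]
        constructor
        · rintro ⟨h1, h2⟩
          exact ⟨fun b hb hab => h2 ⟨hab.1, b, hb, hab.2⟩, h1⟩
        · rintro ⟨h1, h2⟩
          exact ⟨h2, fun ⟨ha, b, hb, hb'⟩ => h1 b hb ⟨ha, hb'⟩⟩
  exact isRegular_ofPred_of_foldr _ _ Prod.snd fun x => by rw [key]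

end Language

/-! ### Words marked with assignments -/

section Marking

variable {T : Type u}

/-- The part of an assignment concerning the center of a slice and the edges starting there: the
vertex variables with this value, for each edge variable the out-frontier vertices through which
its value leaves the center, and likewise for the set variables. -/
@[ext]
structure Marking (n m p q : ℕ) where
  vertex : Fin n → Prop
  edge : Fin m → Set ℕ
  vertexSet : Fin p → Prop
  edgeSet : Fin q → Set ℕ

/-- The word over the marked alphabet obtained from `U` by marking positions. -/
def mark {A : Type} (U : List (UnitSlice T)) (f : Fin U.length → A) :
    List (UnitSlice T × A) := List.ofFn fun k => (U[k], f k)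

variable {A B : Type} (U : List (UnitSlice T))

theorem exists_mem_mark_iff {f : Fin U.length → A} {P : UnitSlice T × A → Prop} :
    mark U f ∈ Language.ofPred (fun x => ∃ a ∈ x, P a) ↔ ∃ k, P (U[k], f k) := by
  simp [Language.mem_ofPred, mark, List.mem_ofFn]

theorem forall_mem_mark_iff {f : Fin U.length → A} {P : UnitSlice T × A → Prop} :
    mark U f ∈ Language.ofPred (fun x => ∀ a ∈ x, P a) ↔ ∀ k, P (U[k], f k) := by
  simp only [Language.mem_ofPred, mark]
  exact List.forall_mem_ofFn_iff

theorem pairwise_mark_iff {f : Fin U.length → A} {P : UnitSlice T × A → Prop} :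
    mark U f ∈ Language.ofPred (fun x => x.Pairwise fun a b => ¬ (P a ∧ P b)) ↔
      ∀ i j, P (U[i], f i) → P (U[j], f j) → i = j := by
  rw [Language.mem_ofPred, mark, List.pairwise_ofFn]
  constructor
  · intro h i j hi hj
    rcases lt_trichotomy i j with h' | h' | h'
    exacts [(h h' ⟨hi, hj⟩).elim, h', (h h' ⟨hj, hi⟩).elim]
  · intro h i j hij hP
    exact hij.ne (h i j hP.1 hP.2)

/-- The relabelling keeps the slice component, so every preimage of a marked word is a marking of
the same `U`. This turns projection of languages into quantification over markings. -/
theorem mark_mem_image_iff (L : Language (UnitSlice T × A)) (g : A → B)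
    (f : Fin U.length → B) :
    (∃ x ∈ L, x.map (Prod.map id g) = mark U f) ↔
      ∃ f', mark U f' ∈ L ∧ ∀ k, g (f' k) = f k := by
  constructor
  · rintro ⟨x, hx, hxf⟩
    have hlen : x.length = U.length := by
      have := congrArg List.length hxf
      simpa [mark] using this
    have hget : ∀ k : Fin U.length, Prod.map id g (x[(k : ℕ)]'(by omega)) = (U[k], f k) := by
      intro k
      have h1 : (List.map (Prod.map id g) x)[(k : ℕ)]? = (mark U f)[(k : ℕ)]? := by rw [hxf]
      simpa [mark, List.getElem?_eq_getElem (show (k : ℕ) < x.length by omega)] using h1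
    refine ⟨fun k => (x[(k : ℕ)]'(by omega)).2, ?_, fun k => congrArg Prod.snd (hget k)⟩
    convert hx
    refine List.ext_getElem (by simp [mark, hlen]) fun i h1 h2 => ?_
    simp only [mark, List.getElem_ofFn]
    exact Prod.ext (congrArg Prod.fst (hget ⟨i, by omega⟩)).symm rfl
  · rintro ⟨f', hL, hf⟩
    refine ⟨_, hL, ?_⟩
    simp only [mark, List.map_ofFn]
    congr 1
    funext k
    simp [hf]

namespace Marking

variable {n m p q : ℕ}

def dropVertex (a : Marking (n + 1) m p q) : Marking n m p q :=
  { a with vertex := fun i => a.vertex i.succ }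

def dropEdge (a : Marking n (m + 1) p q) : Marking n m p q :=
  { a with edge := fun i => a.edge i.succ }

def dropVertexSet (a : Marking n m (p + 1) q) : Marking n m p q :=
  { a with vertexSet := fun i => a.vertexSet i.succ }

def dropEdgeSet (a : Marking n m p (q + 1)) : Marking n m p q :=
  { a with edgeSet := fun i => a.edgeSet i.succ }

end Marking

/-- The marking describing an assignment. -/
def Layout.marking {H : LDAG T} {U : List (UnitSlice T)} (f : Layout H U) {n m p q : ℕ}
    (xs : Fin n → H.V) (ys : Fin m → H.E) (Xs : Fin p → Set H.V) (Ys : Fin q → Set H.E)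
    (k : Fin U.length) : Marking n m p q where
  vertex i := f.pos (xs i) = k
  edge i := {j | f.code (ys i) = ((k : ℕ), j)}
  vertexSet i := f.pos.symm k ∈ Xs i
  edgeSet i := {j | ∃ e ∈ Ys i, f.code e = ((k : ℕ), j)}

theorem Layout.mem_marking_edge {H : LDAG T} {U : List (UnitSlice T)} {f : Layout H U}
    {n m p q : ℕ} {xs : Fin n → H.V} {ys : Fin m → H.E} {Xs : Fin p → Set H.V}
    {Ys : Fin q → Set H.E} {k : Fin U.length} {i : Fin m} {j : ℕ} :
    j ∈ (f.marking xs ys Xs Ys k).edge i ↔ f.code (ys i) = (↑k, j) := Iff.rfl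

theorem Layout.mem_marking_edgeSet {H : LDAG T} {U : List (UnitSlice T)} {f : Layout H U}
    {n m p q : ℕ} {xs : Fin n → H.V} {ys : Fin m → H.E} {Xs : Fin p → Set H.V}
    {Ys : Fin q → Set H.E} {k : Fin U.length} {i : Fin q} {j : ℕ} :
    j ∈ (f.marking xs ys Xs Ys k).edgeSet i ↔ ∃ e ∈ Ys i, f.code e = (↑k, j) := Iff.rfl

/-- Every member of `J` is an out-frontier vertex joined to the center. -/
def UnitSlice.AllStart (S : UnitSlice T) (J : Set ℕ) : Prop := ∀ j ∈ J, S.Starts j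

/-! ### The target relation -/

open Classical in
/-- One step, from right to left, of the computation which determines whether a marked edge ends in
a marked vertex. The first component of the state holds the out-frontier vertices from which the
marked vertex is reached. -/
noncomputable def targetStep (c : ℕ) (P : UnitSlice T × A → Prop) (J : UnitSlice T × A → Set ℕ)
    (a : UnitSlice T × A) (s : (Fin c → Prop) × Prop) : (Fin c → Prop) × Prop :=
  (fun i => if h : (i : ℕ) < a.1.inn then
      match a.1.pass ⟨i, h⟩ with
      | some j => ∃ h : (j : ℕ) < c, s.1 ⟨j, h⟩
      | none => P a
    -- An index outside the in-frontier has default `trace` `0`, which points to the current slice.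
    else P a,
    (∃ j : Fin c, (j : ℕ) ∈ J a ∧ s.1 j) ∨ s.2)

/-- This is the invariant of the right-to-left run. The bound on out-frontiers ensures that the
index to which an edge is passed on is still among the `c` indices remembered. -/
theorem foldr_targetStep (c : ℕ) (P : UnitSlice T × A → Prop) (J : UnitSlice T × A → Set ℕ)
    (x : List (UnitSlice T × A)) (hx : ∀ a ∈ x, a.1.out ≤ c) :
    x.foldr (targetStep c P J) (fun _ => False, False) =
      (fun i : Fin c => ∃ a, x[trace (x.map Prod.fst) i]? = some a ∧ P a,
        ∃ (k : ℕ) (j : Fin c) (a b : _), x[k]? = some a ∧ (j : ℕ) ∈ J a ∧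
          x[edgeTarget (x.map Prod.fst) (k, j)]? = some b ∧ P b) := by
  induction x with
  | nil => simp
  | cons a x ih =>
    rw [List.foldr_cons, ih fun b hb => hx b (List.mem_cons_of_mem _ hb)]
    ext i
    · simp only [targetStep, List.map_cons]
      split_ifs with h
      · split
        · next j hj =>
          have hjc : (j : ℕ) < c := j.2.trans_le (hx a List.mem_cons_self)
          have : trace (a.1 :: x.map Prod.fst) i = trace (x.map Prod.fst) j + 1 :=
            trace_cons_of_pass_eq_some _ hj
          simp [this, hjc]
        · next hj =>
          have : trace (a.1 :: x.map Prod.fst) i = 0 := trace_cons_of_pass_eq_none _ hj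
          simp [this]
      · have : trace (a.1 :: x.map Prod.fst) i = 0 := by simp [trace, h]
        simp [this]
    · simp only [targetStep, List.map_cons]
      constructor
      · rintro (⟨j, hj, b, hb, hP⟩ | ⟨k, j, a', b, ha', hj, hb, hP⟩)
        · exact ⟨0, j, a, b, rfl, hj, by rwa [edgeTarget_cons_zero, List.getElem?_cons_succ], hP⟩
        · exact ⟨k + 1, j, a', b, by simpa using ha', hj,
            by rwa [edgeTarget_cons_succ, List.getElem?_cons_succ], hP⟩
      · rintro ⟨k | k, j, a', b, ha', hj, hb, hP⟩
        · simp only [List.getElem?_cons_zero, Option.some.injEq] at ha'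
          subst ha'
          rw [edgeTarget_cons_zero, List.getElem?_cons_succ] at hb
          exact .inl ⟨j, hj, b, hb, hP⟩
        · rw [edgeTarget_cons_succ, List.getElem?_cons_succ] at hb
          exact .inr ⟨k, j, a', b, by simpa using ha', hj, hb, hP⟩

theorem exists_isRegular_target (T : Type u) (A : Type) (c : ℕ) (P : UnitSlice T × A → Prop)
    (J : UnitSlice T × A → Set ℕ) : ∃ L : Language (UnitSlice T × A), L.IsRegular ∧
      ∀ (U : List (UnitSlice T)) (f : Fin U.length → A), (∀ S ∈ U, S ∈ sliceAlphabet c T) →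
        (mark U f ∈ L ↔ ∃ (k : Fin U.length) (j : Fin c) (l : Fin U.length),
          (j : ℕ) ∈ J (U[k], f k) ∧ (l : ℕ) = edgeTarget U (k, j) ∧ P (U[l], f l)) := by
  refine ⟨_, Language.isRegular_ofPred_of_foldr (targetStep c P J) (fun _ => False, False) Prod.snd
    fun _ => Iff.rfl, ?_⟩
  intro U f hU
  have hout : ∀ a ∈ mark U f, a.1.out ≤ c := by
    refine (forall_mem_mark_iff U (P := fun a => a.1.out ≤ c)).2 ?_
    intro k
    exact (le_max_right _ _).trans (hU _ (List.getElem_mem _))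
  have hmap : (mark U f).map Prod.fst = U := by
    simp only [mark, List.map_ofFn]
    exact List.ofFn_getElem
  have hget : ∀ (k : ℕ) a, (mark U f)[k]? = some a ↔
      ∃ h : k < U.length, a = (U[k], f ⟨k, h⟩) := by
    intro k a
    rw [List.getElem?_eq_some_iff]
    simp [mark, eq_comm]
  rw [Language.mem_ofPred, foldr_targetStep c P J _ hout, hmap]
  simp only [hget]
  constructor
  · rintro ⟨k, j, _, _, ⟨hk, rfl⟩, hj, ⟨hl, rfl⟩, hP⟩
    exact ⟨⟨k, hk⟩, j, ⟨_, hl⟩, hj, rfl, hP⟩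
  · rintro ⟨k, j, ⟨l, hl⟩, hj, h, hP⟩
    dsimp only at h
    subst h
    exact ⟨k, j, _, _, ⟨k.2, rfl⟩, hj, ⟨hl, rfl⟩, hP⟩

/-! ### Truth in a composed DAG is recognizable -/

/-- A finite automaton reading marked slices of width at most `c` decides the truth of `φ`. -/
def MSO₂.Recognizable (c : ℕ) {n m p q : ℕ} (φ : MSO₂ T n m p q) : Prop :=
  ∃ L : Language (UnitSlice T × Marking n m p q), L.IsRegular ∧
    ∀ (U : List (UnitSlice T)), (∀ S ∈ U, S ∈ sliceAlphabet c T) → ∀ (H : LDAG T)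
      (f : Layout H U) (xs : Fin n → H.V) (ys : Fin m → H.E) (Xs : Fin p → Set H.V)
      (Ys : Fin q → Set H.E), φ.Sat H xs ys Xs Ys ↔ mark U (f.marking xs ys Xs Ys) ∈ L

/-! ### Markings arising from a value of one more variable -/

namespace Layout

variable {H : LDAG T} {U} (f : Layout H U) {n m p q : ℕ}
  (xs : Fin n → H.V) (ys : Fin m → H.E) (Xs : Fin p → Set H.V) (Ys : Fin q → Set H.E)

theorem code_fst_lt (e : H.E) : (f.code e).1 < U.length := by
  rw [← f.pos_src]
  exact (f.pos _).2

theorem starts_of_code_eq {e : H.E} {k : Fin U.length} {j : ℕ} (h : f.code e = ((k : ℕ), j)) :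
    U[k].Starts j := by
  obtain ⟨S, hS, hj⟩ := (f.mem_range_code ((k : ℕ), j)).1 ⟨e, h⟩
  rw [List.getElem?_eq_getElem k.2, Option.some.injEq] at hS
  exact hS ▸ hj

theorem exists_code_eq {k : Fin U.length} {j : ℕ} (h : U[k].Starts j) :
    ∃ e, f.code e = ((k : ℕ), j) :=
  (f.mem_range_code ((k : ℕ), j)).2 ⟨_, List.getElem?_eq_getElem k.2, h⟩

/-- Here and in the analogues for the other sorts, the markings that encode some value of the new
variable are singled out by letterwise and at-most-once conditions. These are regular, so a
quantifier becomes a projection. -/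
theorem exists_marking_vecCons_vertex_iff (g : Fin U.length → Marking (n + 1) m p q) :
    (∃ v, f.marking (Matrix.vecCons v xs) ys Xs Ys = g) ↔
      (∀ k, (g k).dropVertex = f.marking xs ys Xs Ys k) ∧ (∃ k, (g k).vertex 0) ∧
        ∀ k l, (g k).vertex 0 → (g l).vertex 0 → k = l := by
  constructor
  · rintro ⟨v, rfl⟩
    exact ⟨fun k => rfl, ⟨f.pos v, rfl⟩, fun k l hk hl => hk.symm.trans hl⟩
  · rintro ⟨h, ⟨k₀, hk₀⟩, hu⟩
    refine ⟨f.pos.symm k₀, funext fun k => ?_⟩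
    have hk := h k
    ext1
    · funext i
      cases i using Fin.cases with
      | zero =>
        simp only [marking, Matrix.cons_val_zero, Equiv.apply_symm_apply]
        exact propext ⟨fun h => h ▸ hk₀, hu k₀ k hk₀⟩
      | succ i => exact (congrFun (congrArg Marking.vertex hk) i).symm
    · exact (congrArg Marking.edge hk).symm
    · exact (congrArg Marking.vertexSet hk).symm
    · exact (congrArg Marking.edgeSet hk).symm

theorem exists_marking_vecCons_edge_iff (g : Fin U.length → Marking n (m + 1) p q) :
    (∃ e, f.marking xs (Matrix.vecCons e ys) Xs Ys = g) ↔
      (∀ k, (g k).dropEdge = f.marking xs ys Xs Ys k) ∧ (∃ k, ((g k).edge 0).Nonempty) ∧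
        (∀ k l, ((g k).edge 0).Nonempty → ((g l).edge 0).Nonempty → k = l) ∧
        ∀ k, U[k].AllStart ((g k).edge 0) ∧ ((g k).edge 0).Subsingleton := by
  constructor
  · rintro ⟨e, rfl⟩
    refine ⟨fun k => rfl, ⟨⟨_, f.code_fst_lt e⟩, (f.code e).2,
      mem_marking_edge.2 rfl⟩, ?_, ?_⟩
    · rintro k l ⟨i, hi⟩ ⟨j, hj⟩
      exact Fin.ext (Prod.mk.inj
        ((mem_marking_edge.1 hi).symm.trans (mem_marking_edge.1 hj))).1
    · exact fun k => ⟨fun j hj => f.starts_of_code_eq (mem_marking_edge.1 hj),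
        fun i hi j hj => (Prod.mk.inj
          ((mem_marking_edge.1 hi).symm.trans (mem_marking_edge.1 hj))).2⟩
  · rintro ⟨h, ⟨k₀, j₀, hj₀⟩, hu, hs⟩
    obtain ⟨e, he⟩ := f.exists_code_eq ((hs k₀).1 _ hj₀)
    refine ⟨e, funext fun k => ?_⟩
    have hk := h k
    ext1
    · exact (congrArg Marking.vertex hk).symm
    · funext i
      cases i using Fin.cases with
      | zero =>
        ext j
        simp only [mem_marking_edge, Matrix.cons_val_zero, he, Prod.mk.injEq]
        constructor
        · rintro ⟨h1, rfl⟩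
          rwa [← Fin.ext h1]
        · intro hj
          obtain rfl := hu k₀ k ⟨_, hj₀⟩ ⟨_, hj⟩
          exact ⟨rfl, (hs k₀).2 hj₀ hj⟩
      | succ i => exact (congrFun (congrArg Marking.edge hk) i).symm
    · exact (congrArg Marking.vertexSet hk).symm
    · exact (congrArg Marking.edgeSet hk).symm

theorem exists_marking_vecCons_vertexSet_iff (g : Fin U.length → Marking n m (p + 1) q) :
    (∃ X, f.marking xs ys (Matrix.vecCons X Xs) Ys = g) ↔
      ∀ k, (g k).dropVertexSet = f.marking xs ys Xs Ys k := by
  constructor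
  · rintro ⟨X, rfl⟩
    exact fun k => rfl
  · intro h
    refine ⟨{v | (g (f.pos v)).vertexSet 0}, funext fun k => ?_⟩
    have hk := h k
    ext1
    · exact (congrArg Marking.vertex hk).symm
    · exact (congrArg Marking.edge hk).symm
    · funext i
      cases i using Fin.cases with
      | zero => simp [marking]
      | succ i => exact (congrFun (congrArg Marking.vertexSet hk) i).symm
    · exact (congrArg Marking.edgeSet hk).symm

/-- Since the codes enumerate the edges, the only restriction on a marking is that every marked
frontier vertex is really joined to its center. -/
theorem exists_marking_vecCons_edgeSet_iff (g : Fin U.length → Marking n m p (q + 1)) :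
    (∃ Y, f.marking xs ys Xs (Matrix.vecCons Y Ys) = g) ↔
      (∀ k, (g k).dropEdgeSet = f.marking xs ys Xs Ys k) ∧
        ∀ k : Fin U.length, U[k].AllStart ((g k).edgeSet 0) := by
  constructor
  · rintro ⟨Y, rfl⟩
    refine ⟨fun k => rfl, fun k j hj => ?_⟩
    obtain ⟨e, -, he⟩ := mem_marking_edgeSet.1 hj
    exact f.starts_of_code_eq he
  · rintro ⟨h, hs⟩
    refine ⟨{e | (f.code e).2 ∈ (g ⟨_, f.code_fst_lt e⟩).edgeSet 0}, funext fun k => ?_⟩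
    have hk := h k
    ext1
    · exact (congrArg Marking.vertex hk).symm
    · exact (congrArg Marking.edge hk).symm
    · exact (congrArg Marking.vertexSet hk).symm
    · funext i
      cases i using Fin.cases with
      | zero =>
        ext j
        simp only [mem_marking_edgeSet, Matrix.cons_val_zero, Set.mem_ofPred_eq]
        constructor
        · rintro ⟨e, he, hc⟩
          simpa only [hc, Fin.eta] using he
        · intro hj
          obtain ⟨e, he⟩ := f.exists_code_eq (hs k j hj)
          exact ⟨e, by simpa only [he, Fin.eta] using hj, he⟩
      | succ i => exact (congrFun (congrArg Marking.edgeSet hk) i).symm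

end Layout

namespace MSO₂

variable (c : ℕ) {n m p q : ℕ}

/-- Recognizability of formulas saying that some marked slice satisfies `P`. -/
theorem recognizable_of_exists (φ : MSO₂ T n m p q) (P : UnitSlice T × Marking n m p q → Prop)
    (h : ∀ (U : List (UnitSlice T)) (H : LDAG T) (f : Layout H U) xs ys Xs Ys,
      φ.Sat H xs ys Xs Ys ↔ ∃ k, P (U[k], f.marking xs ys Xs Ys k)) : φ.Recognizable c := by
  refine ⟨_, Language.isRegular_exists_mem P, fun U _ H f xs ys Xs Ys => ?_⟩
  rw [h U H f]
  exact (exists_mem_mark_iff U).symm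

/-- Recognizability of formulas with a quantifier over objects which correspond to the markings
satisfying a regular condition. -/
theorem recognizable_of_image {n' m' p' q' : ℕ} {φ : MSO₂ T n m p q}
    {ψ : MSO₂ T n' m' p' q'} (hψ : ψ.Recognizable c)
    (g : Marking n' m' p' q' → Marking n m p q)
    {K : Language (UnitSlice T × Marking n' m' p' q')} (hK : K.IsRegular)
    (h : ∀ L : Language (UnitSlice T × Marking n' m' p' q'),
      (∀ (U : List (UnitSlice T)), (∀ S ∈ U, S ∈ sliceAlphabet c T) → ∀ (H : LDAG T)
        (f : Layout H U) xs ys Xs Ys,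
          ψ.Sat H xs ys Xs Ys ↔ mark U (f.marking xs ys Xs Ys) ∈ L) →
      ∀ (U : List (UnitSlice T)), (∀ S ∈ U, S ∈ sliceAlphabet c T) → ∀ (H : LDAG T)
        (f : Layout H U) xs ys Xs Ys, φ.Sat H xs ys Xs Ys ↔
          ∃ g', mark U g' ∈ L ⊓ K ∧ ∀ k, g (g' k) = f.marking xs ys Xs Ys k) :
    φ.Recognizable c := by
  obtain ⟨L, hL, hLφ⟩ := hψ
  refine ⟨_, (hL.inf hK).image_map (Prod.map id g), fun U hU H f xs ys Xs Ys => ?_⟩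
  rw [h L hLφ U hU H f]
  exact (mark_mem_image_iff U (L ⊓ K) g _).symm

theorem recognizable (φ : MSO₂ T n m p q) : φ.Recognizable c := by
  induction φ with
  | memV x X =>
    refine recognizable_of_exists c _ (fun a => a.2.vertex x ∧ a.2.vertexSet X) ?_
    intro U H f xs ys Xs Ys
    simp [Sat, Layout.marking]
  | memE y Y =>
    refine recognizable_of_exists c _ (fun a => ∃ j, j ∈ a.2.edge y ∧ j ∈ a.2.edgeSet Y) ?_
    intro U H f xs ys Xs Ys
    simp only [Sat, Layout.mem_marking_edge, Layout.mem_marking_edgeSet]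
    constructor
    · intro h
      exact ⟨⟨_, f.code_fst_lt (ys y)⟩, (f.code (ys y)).2, rfl, _, h, rfl⟩
    -- A common mark names one code, hence one edge.
    · rintro ⟨k, j, h1, e, he, h2⟩
      rwa [f.code_injective (h1.trans h2.symm)]
  | src y x =>
    refine recognizable_of_exists c _ (fun a => (a.2.edge y).Nonempty ∧ a.2.vertex x) ?_
    intro U H f xs ys Xs Ys
    simp only [Sat, Layout.marking]
    constructor
    · intro h
      refine ⟨f.pos (xs x), ⟨(f.code (ys y)).2, ?_⟩, rfl⟩
      rw [← h]
      exact Prod.ext (f.pos_src _).symm rfl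
    · rintro ⟨k, ⟨j, hj⟩, rfl⟩
      apply f.pos.injective
      apply Fin.ext
      rw [f.pos_src, show f.code (ys y) = _ from hj]
  | tgt y x =>
    obtain ⟨L, hL, h⟩ := exists_isRegular_target T (Marking _ _ _ _) c
      (fun a => a.2.vertex x) (fun a => a.2.edge y)
    refine ⟨L, hL, fun U hU H f xs ys Xs Ys => ?_⟩
    rw [h U _ hU]
    simp only [Sat, Layout.mem_marking_edge]
    simp only [Layout.marking]
    constructor
    · intro ht
      obtain ⟨S, hS, hj, -⟩ := (f.mem_range_code _).1 ⟨ys y, rfl⟩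
      -- The width bound makes the number of the marked edge visible to the finite automaton.
      have hc : (f.code (ys y)).2 < c :=
        hj.trans_le ((le_max_right _ _).trans (hU S (List.mem_of_getElem? hS)))
      refine ⟨⟨_, f.code_fst_lt (ys y)⟩, ⟨_, hc⟩, f.pos (xs x), rfl, ?_, rfl⟩
      rw [← ht, f.pos_tgt]
    · rintro ⟨k, j, _, h1, h2, rfl⟩
      apply f.pos.injective
      apply Fin.ext
      rw [f.pos_tgt, h1, h2]
  | lab x a =>
    refine recognizable_of_exists c _ (fun b => b.2.vertex x ∧ b.1.label = a) ?_
    intro U H f xs ys Xs Ys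
    simp only [Sat, Layout.marking, exists_eq_left', f.label_pos]
  | and φ ψ ih₁ ih₂ =>
    obtain ⟨L₁, h₁, h₁'⟩ := ih₁
    obtain ⟨L₂, h₂, h₂'⟩ := ih₂
    refine ⟨_, h₁.inf h₂, fun U hU H f xs ys Xs Ys => ?_⟩
    rw [Sat, h₁' U hU H f, h₂' U hU H f]
    rfl
  | or φ ψ ih₁ ih₂ =>
    obtain ⟨L₁, h₁, h₁'⟩ := ih₁
    obtain ⟨L₂, h₂, h₂'⟩ := ih₂
    refine ⟨_, h₁.add h₂, fun U hU H f xs ys Xs Ys => ?_⟩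
    rw [Sat, h₁' U hU H f, h₂' U hU H f]
    rfl
  | not φ ih =>
    obtain ⟨L, h, h'⟩ := ih
    refine ⟨_, h.compl, fun U hU H f xs ys Xs Ys => ?_⟩
    rw [Sat, h' U hU H f]
    rfl
  | exV φ ih =>
    refine recognizable_of_image c ih Marking.dropVertex
      ((Language.isRegular_exists_mem fun a => a.2.vertex 0).inf
        (Language.isRegular_pairwise_not_and fun a => a.2.vertex 0)) ?_
    intro L hL U hU H f xs ys Xs Ys
    simp only [Sat, hL U hU H f]
    constructor
    · rintro ⟨v, hv⟩
      obtain ⟨h1, h2, h3⟩ := (f.exists_marking_vecCons_vertex_iff xs ys Xs Ys _).1 ⟨v, rfl⟩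
      exact ⟨_, ⟨hv, (exists_mem_mark_iff U).2 h2,
        (pairwise_mark_iff U).2 h3⟩, h1⟩
    · rintro ⟨g, ⟨hg, h2, h3⟩, h1⟩
      obtain ⟨v, rfl⟩ := (f.exists_marking_vecCons_vertex_iff xs ys Xs Ys g).2
        ⟨h1, (exists_mem_mark_iff U).1 h2,
          (pairwise_mark_iff U).1 h3⟩
      exact ⟨v, hg⟩
  | exE φ ih =>
    refine recognizable_of_image c ih Marking.dropEdge
      ((Language.isRegular_exists_mem fun a => (a.2.edge 0).Nonempty).inf
        ((Language.isRegular_pairwise_not_and fun a => (a.2.edge 0).Nonempty).inf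
          (Language.isRegular_forall_mem fun a =>
            a.1.AllStart (a.2.edge 0) ∧ (a.2.edge 0).Subsingleton))) ?_
    intro L hL U hU H f xs ys Xs Ys
    simp only [Sat, hL U hU H f]
    constructor
    · rintro ⟨v, hv⟩
      obtain ⟨h1, h2, h3, h4⟩ := (f.exists_marking_vecCons_edge_iff xs ys Xs Ys _).1 ⟨v, rfl⟩
      exact ⟨_, ⟨hv, (exists_mem_mark_iff U).2 h2,
        (pairwise_mark_iff U).2 h3,
        (forall_mem_mark_iff U).2 h4⟩, h1⟩
    · rintro ⟨g, ⟨hg, h2, h3, h4⟩, h1⟩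
      obtain ⟨v, rfl⟩ := (f.exists_marking_vecCons_edge_iff xs ys Xs Ys g).2
        ⟨h1, (exists_mem_mark_iff U).1 h2,
          (pairwise_mark_iff U).1 h3,
          (forall_mem_mark_iff U).1 h4⟩
      exact ⟨v, hg⟩
  | exVS φ ih =>
    refine recognizable_of_image c ih Marking.dropVertexSet
      -- Every choice of positions is a vertex set, so no condition is imposed.
      (Language.isRegular_forall_mem fun _ => True) ?_
    intro L hL U hU H f xs ys Xs Ys
    simp only [Sat, hL U hU H f]
    constructor
    · rintro ⟨v, hv⟩
      exact ⟨_, ⟨hv, fun _ _ => trivial⟩,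
        (f.exists_marking_vecCons_vertexSet_iff xs ys Xs Ys _).1 ⟨v, rfl⟩⟩
    · rintro ⟨g, ⟨hg, -⟩, h1⟩
      obtain ⟨v, rfl⟩ := (f.exists_marking_vecCons_vertexSet_iff xs ys Xs Ys g).2 h1
      exact ⟨v, hg⟩
  | exES φ ih =>
    refine recognizable_of_image c ih Marking.dropEdgeSet
      (Language.isRegular_forall_mem fun a => a.1.AllStart (a.2.edgeSet 0)) ?_
    intro L hL U hU H f xs ys Xs Ys
    simp only [Sat, hL U hU H f]
    constructor
    · rintro ⟨v, hv⟩
      obtain ⟨h1, h2⟩ := (f.exists_marking_vecCons_edgeSet_iff xs ys Xs Ys _).1 ⟨v, rfl⟩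
      exact ⟨_, ⟨hv, (forall_mem_mark_iff U).2 h2⟩, h1⟩
    · rintro ⟨g, ⟨hg, h2⟩, h1⟩
      obtain ⟨v, rfl⟩ := (f.exists_marking_vecCons_edgeSet_iff xs ys Xs Ys g).2
        ⟨h1, (forall_mem_mark_iff U).1 h2⟩
      exact ⟨v, hg⟩

end MSO₂

end Marking

/-! ### Slice automata -/

section Automaton

variable {T : Type u} {c : ℕ}

/-- The nondeterministic automaton which runs the finite automaton `M` on composable unit slices of
width at most `c` and remembers the size of the last out-frontier; `none` is the initial state. -/
def sliceNFA (c : ℕ) {σ : Type} (M : DFA (UnitSlice T) σ) :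
    NFA (UnitSlice T) (Option (σ × Fin (c + 1))) where
  step q S := {q' | S ∈ sliceAlphabet c T ∧ S.inn = q.elim 0 (fun s => (s.2 : ℕ)) ∧
    ∃ k : Fin (c + 1), q' = some (M.step (q.elim M.start Prod.fst) S, k) ∧ (k : ℕ) = S.out}
  start := {none}
  accept := {q | q.elim M.start Prod.fst ∈ M.accept ∧ q.elim 0 (fun s => (s.2 : ℕ)) = 0}

theorem mem_step_sliceNFA {σ : Type} (M : DFA (UnitSlice T) σ) (S : UnitSlice T)
    (q q' : Option (σ × Fin (c + 1))) : q' ∈ (sliceNFA c M).step q S ↔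
      S ∈ sliceAlphabet c T ∧ S.inn = q.elim 0 (fun s => (s.2 : ℕ)) ∧
      ∃ k : Fin (c + 1), q' = some (M.step (q.elim M.start Prod.fst) S, k) ∧ (k : ℕ) = S.out :=
  Iff.rfl

theorem mem_accept_sliceNFA {σ : Type} (M : DFA (UnitSlice T) σ) (q : Option (σ × Fin (c + 1))) :
    q ∈ (sliceNFA c M).accept ↔
      q.elim M.start Prod.fst ∈ M.accept ∧ q.elim 0 (fun s => (s.2 : ℕ)) = 0 :=
  Iff.rfl

/-- The slice automaton with the transitions of `sliceNFA`. -/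
def sliceAutomatonOfDFA (c : ℕ) {σ : Type} [Finite σ] (M : DFA (UnitSlice T) σ) :
    SliceAutomaton c T where
  Q := Option (σ × Fin (c + 1))
  finQ := inferInstance
  Δ := {t | t.2.2 ∈ (sliceNFA c M).step t.1 t.2.1}
  q₀ := none
  F := (sliceNFA c M).accept
  alphabet := fun _ _ _ h => h.1
  initial := fun _ _ h => h.2.1
  final := by
    intro q S q' h h'
    obtain ⟨-, -, k, rfl, hk⟩ := (mem_step_sliceNFA M S q q').1 h
    exact hk.symm.trans h'.2
  glue := by
    intro q S q' S' q'' h h'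
    obtain ⟨-, -, k, rfl, hk⟩ := (mem_step_sliceNFA M S q q').1 h
    exact hk.symm.trans h'.2.1.symm

/-- For the induction the start state is arbitrary: the frontier size it stores replaces the
requirement of an empty first in-frontier, and also stands in for the last out-frontier of the empty
word. -/
theorem mem_acceptsFrom_sliceNFA {σ : Type} (M : DFA (UnitSlice T) σ)
    (U : List (UnitSlice T)) (q : Option (σ × Fin (c + 1))) :
    U ∈ (sliceNFA c M).acceptsFrom {q} ↔
      (∀ S ∈ U, S ∈ sliceAlphabet c T) ∧ U.IsChain (fun S S' => S.out = S'.inn) ∧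
      (∀ S ∈ U.head?, S.inn = q.elim 0 fun s => (s.2 : ℕ)) ∧
      (U.getLast?.elim (q.elim 0 fun s => (s.2 : ℕ)) UnitSlice.out) = 0 ∧
      M.evalFrom (q.elim M.start Prod.fst) U ∈ M.accept := by
  induction U generalizing q with
  | nil =>
    rw [NFA.nil_mem_acceptsFrom]
    simp [mem_accept_sliceNFA, and_comm]
  | cons S U ih =>
    have hcons : S :: U ∈ (sliceNFA c M).acceptsFrom {q} ↔
        ∃ q' ∈ (sliceNFA c M).step q S,
          U ∈ (sliceNFA c M).acceptsFrom {q'} := by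
      rw [NFA.cons_mem_acceptsFrom, NFA.stepSet_singleton, NFA.mem_acceptsFrom]
      simp only [NFA.mem_acceptsFrom]
      constructor
      · rintro ⟨s, hs, h⟩
        rw [NFA.mem_evalFrom_iff_exists] at h
        obtain ⟨q', hq', h⟩ := h
        exact ⟨q', hq', s, hs, h⟩
      · rintro ⟨q', hq', s, hs, h⟩
        exact ⟨s, hs, NFA.mem_evalFrom_iff_exists.2 ⟨q', hq', h⟩⟩
    rw [hcons]
    simp only [mem_step_sliceNFA, ih]
    have hlast : ∀ a : ℕ, (S :: U).getLast?.elim a UnitSlice.out =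
        U.getLast?.elim S.out UnitSlice.out := by
      intro a
      cases U with
      | nil => rfl
      | cons S' U =>
        rw [List.getLast?_cons_cons]
        cases h : (S' :: U).getLast? with
        | none => simp at h
        | some => rfl
    have hchain : (S :: U).IsChain (fun S S' => S.out = S'.inn) ↔
        (∀ S' ∈ U.head?, S'.inn = S.out) ∧ U.IsChain (fun S S' => S.out = S'.inn) := by
      rw [List.isChain_cons]
      exact and_congr_left fun _ => forall_congr' fun _ => imp_congr_right fun _ => eq_comm
    rw [hlast, hchain]
    simp only [List.forall_mem_cons, List.head?_cons, Option.mem_some_iff, forall_eq',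
      DFA.evalFrom_cons]
    constructor
    · rintro ⟨_, ⟨h1, h2, k, rfl, hk⟩, h3, h4, h5, h6, h7⟩
      simp only [Option.elim_some, hk] at h5 h6 h7
      exact ⟨⟨h1, h3⟩, ⟨h5, h4⟩, h2, h6, h7⟩
    · rintro ⟨⟨h1, h3⟩, ⟨h5, h4⟩, h2, h6, h7⟩
      exact ⟨_, ⟨h1, h2, ⟨S.out, Nat.lt_succ_of_le ((le_max_right _ _).trans h1)⟩, rfl, rfl⟩,
        h3, h4, h5, h6, h7⟩

theorem lang_sliceAutomatonOfDFA {σ : Type} [Finite σ] (M : DFA (UnitSlice T) σ) :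
    (sliceAutomatonOfDFA c M).lang = {U ∈ unitDecompositions c T | U ∈ M.accepts} := by
  ext U
  refine (mem_acceptsFrom_sliceNFA M U none).trans ?_
  simp only [unitDecompositions, Set.mem_ofPred_eq, Option.elim_none]
  have hlast : U.getLast?.elim 0 UnitSlice.out = 0 ↔ ∀ S ∈ U.getLast?, S.out = 0 := by
    cases U.getLast? <;> simp
  rw [hlast]
  constructor
  · rintro ⟨h1, h2, h3, h4, h5⟩
    exact ⟨⟨h1, h2, h3, h4⟩, h5⟩
  · rintro ⟨⟨h1, h2, h3, h4⟩, h5⟩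
    exact ⟨h1, h2, h3, h4, h5⟩

/-- Every `MSO₂` sentence is defined by a slice automaton. -/
theorem MSO₂.exists_defines (c : ℕ) (ψ : MSO₂Sentence T) :
    ∃ A : SliceAutomaton c T, A.Defines ψ := by
  obtain ⟨L, ⟨σ, _, M, rfl⟩, hL⟩ := ψ.recognizable c
  -- Without variables there is only one marking, so the marked alphabet can be pulled back to
  -- unmarked slices.
  let blank : Marking 0 0 0 0 := ⟨Fin.elim0, Fin.elim0, Fin.elim0, Fin.elim0⟩
  have hblank : ∀ a : Marking 0 0 0 0, a = blank := fun a => by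
    ext1 <;> exact Subsingleton.elim _ _
  refine ⟨sliceAutomatonOfDFA c (M.comap fun S => (S, blank)), ?_⟩
  rw [SliceAutomaton.Defines, lang_sliceAutomatonOfDFA]
  ext U
  refine and_congr_right fun hU => ?_
  obtain ⟨f⟩ := hU.2.nonempty_layout
  rw [LDAG.Models, hL U hU.1 _ f, DFA.mem_accepts, DFA.eval_comap, DFA.mem_accepts]
  have : U.map (fun S => (S, blank)) = mark U (f.marking ![] ![] ![] ![]) := by
    rw [mark, funext fun k => hblank (f.marking ![] ![] ![] ![] k)]
    exact (List.ofFn_getElem_eq_map U fun S => (S, blank)).symm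
  rw [this]
  rfl

end Automaton

/-! ### The main theorem -/

section Main

variable {T : Type u} {c : ℕ} {φ : MSOSentence T}

theorem models_and_iff (H : LDAG T) (φ : MSOSentence T) (c : ℕ) :
    H.Models (.and φ.gr (.and MSO₂.rho (MSO₂.gamma c))) ↔
      H.Models φ.gr ∧ H.IsTransReduced ∧ H.CoverableBy c := by
  rw [← H.models_rho_iff, ← H.models_gamma_iff]
  rfl

/-- The width condition disappears because coverability by `c` paths enforces it; saturation rests
on this. -/
theorem SliceAutomaton.Defines.mem_lang_iff {A : SliceAutomaton c T}
    (hA : A.Defines (.and φ.gr (.and MSO₂.rho (MSO₂.gamma c)))) (U : List (UnitSlice T)) :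
    U ∈ A.lang ↔ IsUnitDecomposition U ∧ (composed U).Models φ.gr ∧
      (composed U).IsTransReduced ∧ (composed U).CoverableBy c := by
  rw [hA, ← models_and_iff]
  constructor
  · rintro ⟨⟨-, h1⟩, h2⟩
    exact ⟨h1, h2⟩
  · rintro ⟨h1, h2⟩
    exact ⟨⟨h1.mem_sliceAlphabet ((models_and_iff _ _ _).1 h2).2.2, h1⟩, h2⟩

theorem SliceAutomaton.Defines.isSaturated {A : SliceAutomaton c T}
    (hA : A.Defines (.and φ.gr (.and MSO₂.rho (MSO₂.gamma c)))) : A.IsSaturated := by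
  rintro H ⟨U, hU, ⟨f⟩⟩ U' hU'
  obtain ⟨_, ⟨c', rfl⟩, hU'⟩ := hU'
  obtain ⟨hU', ⟨g⟩⟩ := hU'
  rw [hA.mem_lang_iff, ← models_and_iff] at hU ⊢
  exact ⟨hU'.2, ((f.trans g.symm).models_iff _).1 hU.2⟩

theorem SliceAutomaton.Defines.isTransReduced {A : SliceAutomaton c T}
    (hA : A.Defines (.and φ.gr (.and MSO₂.rho (MSO₂.gamma c)))) : A.IsTransReduced := by
  rintro H ⟨U, hU, ⟨f⟩⟩
  rw [← H.models_rho_iff, ← f.models_iff, LDAG.models_rho_iff]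
  exact ((hA.mem_lang_iff U).1 hU).2.2.1

/-- An accepted DAG is transitively reduced, hence isomorphic to the Hasse diagram of the order it
represents, and truth transfers. Conversely, any unit decomposition of the Hasse diagram of a
`c`-partial order satisfying `φ` is accepted. -/
theorem SliceAutomaton.Defines.poLanguage_eq {A : SliceAutomaton c T}
    (hA : A.Defines (.and φ.gr (.and MSO₂.rho (MSO₂.gamma c)))) :
    poLanguage A.lang = cPartialOrders c T φ := by
  ext ℓ
  constructor
  · rintro ⟨U, hU, hℓ⟩
    obtain ⟨-, h1, h2, h3⟩ := (hA.mem_lang_iff U).1 hU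
    obtain ⟨f⟩ := h2.iso_hasse_tc
    obtain ⟨g⟩ := hℓ.hasse_iso
    refine ⟨?_, ?_⟩
    · rw [← LDAG.models_gamma_iff] at h3 ⊢
      exact ((f.trans g).models_iff _).1 h3
    · rw [ℓ.models_iff_hasse_models]
      exact ((f.trans g).models_iff _).1 h1
  · rintro ⟨h1, h2⟩
    obtain ⟨U, hU, ⟨f⟩⟩ := ℓ.hasse.exists_isUnitDecomposition
    refine ⟨U, ?_, ?_⟩
    · rw [hA.mem_lang_iff, ← models_and_iff]
      refine ⟨hU, (f.models_iff _).2 ?_⟩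
      rw [models_and_iff]
      exact ⟨(ℓ.models_iff_hasse_models φ).1 h2, ℓ.hasse_isTransReduced, h1⟩
    · obtain ⟨g, hg⟩ := f.tc_isIso
      obtain ⟨g', hg'⟩ := ℓ.hasse_tc_isIso
      exact ⟨g.trans g', fun v => (hg' _).trans (hg v)⟩

end Main

theorem mainTheorem7 {T : Type u} [Finite T] (c : ℕ) (φ : MSOSentence T) :
    -- the meaning of the three sentences `φ.gr`, `rho` and `gamma c`
    (∀ ℓ : LPO T, ℓ.Models φ ↔ ℓ.hasse.Models φ.gr) ∧
    (∀ H : LDAG T, H.Models MSO₂.rho ↔ H.IsTransReduced) ∧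
    (∀ H : LDAG T, H.Models (MSO₂.gamma c) ↔ H.CoverableBy c) ∧
    -- the slice automaton of their conjunction exists
    (∃ A : SliceAutomaton c T, A.Defines (.and φ.gr (.and MSO₂.rho (MSO₂.gamma c)))) ∧
    -- and has the asserted properties, however it is constructed
    ∀ A : SliceAutomaton c T, A.Defines (.and φ.gr (.and MSO₂.rho (MSO₂.gamma c))) →
      A.IsSaturated ∧ A.IsTransReduced ∧ poLanguage A.lang = cPartialOrders c T φ :=
  ⟨fun ℓ => ℓ.models_iff_hasse_models φ, LDAG.models_rho_iff, fun H => H.models_gamma_iff c,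
    MSO₂.exists_defines c _, fun _ hA => ⟨hA.isSaturated, hA.isTransReduced, hA.poLanguage_eq⟩⟩
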